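/- An arc-triangle consists of three points of the Euclidean plane (its vertices) and three closed circular arcs (its edges; line segments are allowed as degenerate circular arcs), one joining each pair of vertices. It is simple if any two of its edges meet only in their common vertex; the union of its edges is then a Jordan curve, whose bounded complementary component is its interior. The interior angle at a vertex is the angle in $[0,2\pi]$ between the tangents at that vertex to the two edges that meet there, measured through the interior (so it is $0$ or $2\pi$ when the two edges leave the vertex in the same direction, according to whether the interior lies inside or outside the cusp). Theorem. Let $\theta_0,\theta_1,\theta_2\in[0,2\pi]$, put $\psi=\frac12\bigl(\pi-(\theta_0+\theta_1+\theta_2)\bigr)$ and $\varphi_i=\psi+\theta_i$. There is a simple arc-triangle whose interior angles at its three vertices are $\theta_0,\theta_1,\theta_2$ if and only if $-\pi<\varphi_i<\pi$ for every $i\in\{0,1,2\}$. Moreover, the set of triples $(\theta_0,\theta_1,\theta_2)$ that are realizable in this way is the cube $[0,2\pi]^3$ truncated at six of its corners: exactly six corners of the cube do not have all coordinates equal, and the set is obtained from the cube by removing, for each of these six corners, the closed tetrahedron spanned by the corner and the midpoints of the three cube edges at that corner. -/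

import Mathlib

open Set Filter Topology

/-- A closed circular arc in the Euclidean plane `ℂ`, with two distinct endpoints, given with a
direction of travel: either a line segment, or the arc of the circle with centre `c` and radius `r`
that starts at polar angle `α` and sweeps through the signed angle `κ`, `0 < |κ| < 2π`. -/
inductive CircularArc : Type
  | segment (p q : ℂ) (hpq : p ≠ q) : CircularArc
  | arc (c : ℂ) (r α κ : ℝ) (hr : 0 < r) (hκ : κ ≠ 0) (hκ' : |κ| < 2 * Real.pi) : CircularArc

namespace CircularArc

/-- The constant speed parametrization; the arc itself is traced for `t ∈ [0, 1]`. -/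
noncomputable def param : CircularArc → ℝ → ℂ
  | segment p q _, t => p + (t : ℂ) * (q - p)
  | arc c r α κ _ _ _, t => circleMap c r (α + t * κ)

/-- The set of points of the arc. -/
def carrier (e : CircularArc) : Set ℂ := e.param '' Icc 0 1

/-- The first endpoint. -/
noncomputable def start (e : CircularArc) : ℂ := e.param 0

/-- The second endpoint. -/
noncomputable def finish (e : CircularArc) : ℂ := e.param 1

/-- The tangent vector at the first endpoint, pointing along the arc. -/
noncomputable def tangentAtStart (e : CircularArc) : ℂ := deriv e.param 0

/-- The tangent vector at the second endpoint, pointing (backwards) along the arc. -/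
noncomputable def tangentAtFinish (e : CircularArc) : ℂ := - deriv e.param 1

end CircularArc

/-- An arc-triangle: three points and three circular arcs in cyclic alternation, where `edge i`
joins `vertex i` to `vertex (i + 1)` (indices modulo 3). -/
structure ArcTriangle where
  vertex : Fin 3 → ℂ
  edge : Fin 3 → CircularArc
  start_edge : ∀ i, (edge i).start = vertex i
  finish_edge : ∀ i, (edge i).finish = vertex (i + 1)

namespace ArcTriangle

/-- Two edges meet only in their shared vertex. (Any two of the three edges are consecutive.) -/
def Simple (T : ArcTriangle) : Prop :=
  ∀ i, (T.edge i).carrier ∩ (T.edge (i + 1)).carrier = {T.vertex (i + 1)}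

/-- The union of the edges. -/
def boundary (T : ArcTriangle) : Set ℂ := ⋃ i, (T.edge i).carrier

/-- The interior: the points off the boundary whose component in the complement of the boundary
is bounded. -/
def inside (T : ArcTriangle) : Set ℂ :=
  {z | z ∈ T.boundaryᶜ ∧ Bornology.IsBounded (connectedComponentIn T.boundaryᶜ z)}

/-- The exterior: the points off the boundary whose component in the complement of the boundary
is unbounded. -/
def outside (T : ArcTriangle) : Set ℂ :=
  {z | z ∈ T.boundaryᶜ ∧ ¬ Bornology.IsBounded (connectedComponentIn T.boundaryᶜ z)}

/-- Turning counterclockwise by the angle `θ` from the direction `u` to the direction `w` sweeps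
out exactly the interior of `T` near its boundary point `v`: the directions strictly between lead
from `v` into the interior, and the remaining directions lead into the exterior. -/
def Sweeps (T : ArcTriangle) (v u w : ℂ) (θ : ℝ) : Prop :=
  SameRay ℝ (Complex.exp (θ * Complex.I) * u) w ∧
  (∀ t ∈ Ioo 0 θ, ∀ᶠ r : ℝ in 𝓝[>] 0,
    v + (r : ℂ) * (Complex.exp (t * Complex.I) * u) ∈ T.inside) ∧
  (∀ t ∈ Ioo θ (2 * Real.pi), ∀ᶠ r : ℝ in 𝓝[>] 0,
    v + (r : ℂ) * (Complex.exp (t * Complex.I) * u) ∈ T.outside)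

/-- `θ ∈ [0, 2π]` is the interior angle at `vertex i`: the angle between the tangents there to
`edge i` and to the preceding edge `edge (i + 2)`, on the side of the interior. The interior may
lie on either side of the directed edges, so the turn from one tangent to the other through the
interior may start at either of them. -/
def IsInteriorAngle (T : ArcTriangle) (i : Fin 3) (θ : ℝ) : Prop :=
  θ ∈ Icc 0 (2 * Real.pi) ∧
  (T.Sweeps (T.vertex i) (T.edge i).tangentAtStart (T.edge (i + 2)).tangentAtFinish θ ∨
   T.Sweeps (T.vertex i) (T.edge (i + 2)).tangentAtFinish (T.edge i).tangentAtStart θ)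

end ArcTriangle

/-- The `θ i` are the interior angles of some simple arc-triangle. -/
def RealizableBySimpleArcTriangle (θ : Fin 3 → ℝ) : Prop :=
  ∃ T : ArcTriangle, T.Simple ∧ ∀ i, T.IsInteriorAngle i (θ i)

/-- `φ i = ψ + θ i`, where `ψ = (π - ∑ θ) / 2`. -/
noncomputable def circumcircleAngle (θ : Fin 3 → ℝ) (i : Fin 3) : ℝ :=
  (Real.pi - ∑ j, θ j) / 2 + θ i

/-- The cube `[0, 2π]³`. -/
def angleCube : Set (Fin 3 → ℝ) := {θ | ∀ i, θ i ∈ Icc 0 (2 * Real.pi)}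

/-- The corners of the cube `[0, 2π]³` whose coordinates are not all equal. -/
def mixedCorners : Set (Fin 3 → ℝ) :=
  {c | (∀ i, c i = 0 ∨ c i = 2 * Real.pi) ∧ ∃ i j, c i ≠ c j}

/-- The closed tetrahedron spanned by a corner `c` of the cube and the midpoints of the three cube
edges at `c`. -/
noncomputable def cornerTetrahedron (c : Fin 3 → ℝ) : Set (Fin 3 → ℝ) :=
  convexHull ℝ (insert c (range fun j => Function.update c j Real.pi))

/-!
# Interior angles of simple arc-triangles

An arc from `P` to `Q` that sweeps through the angle `2h`, `|h| < π`, is the set of all `z` at which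
`arcForm P Q h z = e^{-ih} (Q - z) conj (P - z)` lies in `(-∞, 0]`
(`CircularArc.carrier_eq_arcSet`). Evaluated at the third vertex of an arc-triangle, this form has an
argument `g i`, the *deviation* of `edge i`: the signed angle between the edge and the circle (or
line) through the three vertices. So no edge passes through the opposite vertex iff `|g i| < π` for
all `i`. After an inversion at a vertex the two edges there become half lines; computing when these
meet (`arcSet_inter_eq_singleton_iff`) shows that the triangle is simple iff moreover the *turn*
`g i + g (i + 2)` lies in `[-π, π]` for every `i`. The tangents at `vertex i` include the angle
`π - turn i` on the left of the boundary (`exists_tangent_right_eq`).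

Suppose that the `θ i` are the interior angles of a simple arc-triangle. At each vertex
`θ i = π ∓ turn i`, according to whether the interior lies on the left or on the right. The side is
the same at all vertices: an arc from `vertex i` to `vertex (i + 1)` with a slightly different sweep
stays off the boundary, by the same criterion for its deviation, and joins points beside the edge
near its two ends (`ArcTriangle.dirIn_startDir_iff_finishDir`). This fails only on a side on which an
end has a cusp, and the two ends cannot have cusps on different sides. Solving for the deviations
gives `φ i = ± g (i + 1)`, so `|φ i| < π` (`ArcTriangle.abs_circumcircleAngle_lt`). No form of the
Jordan curve theorem is needed here.

Conversely, let `|φ i| < π` and prescribe the deviations `g i = φ (i + 2)`, whose turns are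
`π - θ i ∈ [-π, π]`. The vertices are still free, and a straight triangle with angles `α i` requires
the half sweeps `α (i + 2) - g i`, which have to be less than `π`. The angles can be chosen so that
in addition, at one vertex that has directions on the right of the boundary, the prolongation of a
side escapes to infinity without meeting the boundary (`exists_triangle_angles`,
`ArcTriangle.prolonged_chord_notMem_boundary`). So the right side is outside at that vertex, hence,
moving along the edges as before, at all vertices. The left side is inside because the
boundary winds once around its points: the winding angle, a sum of arguments of the three forms, is
continuous off the boundary, takes values in `2πℤ`, and tends to `0` at infinity
(`ArcTriangle.mem_inside_of_windingAngle_ne_zero`, `ArcTriangle.tendsto_windingAngle`).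

The inequalities `φ i < π` and `-π < φ i` exclude from the cube the tetrahedra at the two corners
whose `i`-th coordinate differs from the other two.
-/

open scoped ComplexConjugate

/-! ### Unit complex numbers and the slit plane -/

/-- The unit complex number `e^{it}`. -/
noncomputable def cis (t : ℝ) : ℂ := Complex.exp (t * Complex.I)

lemma cis_add (s t : ℝ) : cis (s + t) = cis s * cis t := by
  simp [cis, add_mul, Complex.exp_add]

lemma cis_zero : cis 0 = 1 := by simp [cis]

lemma cis_pi : cis Real.pi = -1 := by simp [cis]

lemma cis_two_pi : cis (2 * Real.pi) = 1 := by simp [cis]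

lemma cis_ne_zero (t : ℝ) : cis t ≠ 0 := Complex.exp_ne_zero _

lemma cis_neg_mul_cis (t : ℝ) : cis (-t) * cis t = 1 := by
  rw [← cis_add, neg_add_cancel, cis_zero]

lemma cis_mul_cis_neg (t : ℝ) : cis t * cis (-t) = 1 := by
  rw [mul_comm, cis_neg_mul_cis]

lemma conj_cis (t : ℝ) : conj (cis t) = cis (-t) := by
  simp [cis, ← Complex.exp_conj]

lemma cis_re (t : ℝ) : (cis t).re = Real.cos t := Complex.exp_ofReal_mul_I_re t

lemma cis_im (t : ℝ) : (cis t).im = Real.sin t := Complex.exp_ofReal_mul_I_im t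

lemma norm_cis (t : ℝ) : ‖cis t‖ = 1 := Complex.norm_exp_ofReal_mul_I t

lemma continuous_cis : Continuous cis := by unfold cis; fun_prop

lemma cis_sub_cis (s t : ℝ) :
    cis s - cis t = 2 * Complex.I * Real.sin ((s - t) / 2) * cis ((s + t) / 2) := by
  have h1 : s = (s + t) / 2 + (s - t) / 2 := by ring
  have h2 : t = (s + t) / 2 + -((s - t) / 2) := by ring
  have h3 : cis s = cis ((s + t) / 2) * cis ((s - t) / 2) := by rw [← cis_add, ← h1]
  have h4 : cis t = cis ((s + t) / 2) * cis (-((s - t) / 2)) := by rw [← cis_add, ← h2]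
  rw [h3, h4, ← mul_sub, mul_comm]
  congr 1
  apply Complex.ext <;> simp [cis_re, cis_im, -Complex.ofReal_sin]
  ring

lemma arg_cis {t : ℝ} (ht : t ∈ Ioc (-Real.pi) Real.pi) : (cis t).arg = t :=
  Complex.arg_exp_mul_I t ▸ (toIocMod_eq_self Real.two_pi_pos).2
    (by convert ht using 1; ring_nf)

lemma cis_arg_mul_norm (z : ℂ) : (‖z‖ : ℂ) * cis z.arg = z := Complex.norm_mul_exp_arg_mul_I z

lemma cis_eq_one_iff {t : ℝ} : cis t = 1 ↔ ∃ n : ℤ, t = n * (2 * Real.pi) := by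
  rw [cis, Complex.exp_eq_one_iff]
  refine exists_congr fun n => ?_
  rw [show (n : ℂ) * (2 * Real.pi * Complex.I) = ((n * (2 * Real.pi) : ℝ) : ℂ) * Complex.I by
    push_cast; ring, mul_left_inj' Complex.I_ne_zero, Complex.ofReal_inj]

lemma cis_mem_slitPlane {t : ℝ} (ht : |t| < Real.pi) : cis t ∈ Complex.slitPlane := by
  obtain ⟨h1, h2⟩ := abs_lt.1 ht
  rw [Complex.mem_slitPlane_iff_arg, arg_cis ⟨h1, h2.le⟩]
  exact ⟨h2.ne, cis_ne_zero t⟩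

lemma ofReal_mul_mem_slitPlane {c : ℝ} (hc : 0 < c) {z : ℂ} :
    (c : ℂ) * z ∈ Complex.slitPlane ↔ z ∈ Complex.slitPlane := by
  simp [Complex.mem_slitPlane_iff, hc, hc.ne']

lemma notMem_slitPlane_iff {z : ℂ} : z ∉ Complex.slitPlane ↔ ∃ s : ℝ, 0 ≤ s ∧ z = -s := by
  rw [Complex.mem_slitPlane_iff]
  push Not
  constructor
  · rintro ⟨h1, h2⟩
    exact ⟨-z.re, by linarith, by apply Complex.ext <;> simp [h2]⟩
  · rintro ⟨s, hs, rfl⟩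
    simpa using hs

/-! ### Arcs with given endpoints and given half sweep -/

/-- The form `e^{-ih} (Q - z) conj (P - z)`. Its argument, increased by `h`, is the angle under
which the arc from `P` to `Q` with sweep `2h` is seen from `z`, followed continuously along the
arc. -/
noncomputable def arcForm (P Q : ℂ) (h : ℝ) (z : ℂ) : ℂ := cis (-h) * (Q - z) * conj (P - z)

/-- The arc from `P` to `Q` that sweeps through the signed angle `2h`, `|h| < π`, as the set on
which `arcForm` takes values in `(-∞, 0]`. -/
def arcSet (P Q : ℂ) (h : ℝ) : Set ℂ := {z | arcForm P Q h z ∉ Complex.slitPlane}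

/-- The point of the arc from `P` to `Q` with half sweep `h` that has rational parameter
`l ∈ [0, ∞)`; the parameter `0` gives `Q`, and `P` is the limit as `l → ∞`. -/
noncomputable def arcPoint (P Q : ℂ) (h l : ℝ) : ℂ := (Q + l * cis h * P) / (1 + l * cis h)

lemma continuous_arcForm (P Q : ℂ) (h : ℝ) : Continuous (arcForm P Q h) := by
  unfold arcForm
  have : Continuous fun z : ℂ => conj (P - z) := Complex.continuous_conj.comp (by fun_prop)
  fun_prop

lemma isClosed_arcSet (P Q : ℂ) (h : ℝ) : IsClosed (arcSet P Q h) := by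
  have : arcSet P Q h = arcForm P Q h ⁻¹' (Complex.slitPlane)ᶜ := rfl
  rw [this]
  exact Complex.isOpen_slitPlane.isClosed_compl.preimage (continuous_arcForm P Q h)

lemma left_mem_arcSet (P Q : ℂ) (h : ℝ) : P ∈ arcSet P Q h := by
  simp [arcSet, arcForm]

lemma right_mem_arcSet (P Q : ℂ) (h : ℝ) : Q ∈ arcSet P Q h := by
  simp [arcSet, arcForm]

lemma one_add_mul_cis_ne_zero {h l : ℝ} (hh : |h| < Real.pi) (hl : 0 ≤ l) :
    1 + (l : ℂ) * cis h ≠ 0 := by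
  intro h0
  rcases hl.eq_or_lt with rfl | hl
  · simp at h0
  · have h1 := (ofReal_mul_mem_slitPlane hl).2 (cis_mem_slitPlane hh)
    rw [eq_neg_of_add_eq_zero_right h0] at h1
    norm_num [Complex.mem_slitPlane_iff] at h1

lemma arcPoint_sub_left {P Q : ℂ} {h l : ℝ} (hh : |h| < Real.pi) (hl : 0 ≤ l) :
    arcPoint P Q h l - P = (Q - P) / (1 + l * cis h) := by
  have := one_add_mul_cis_ne_zero hh hl
  rw [arcPoint]
  field_simp
  ring

lemma arcPoint_sub_right {P Q : ℂ} {h l : ℝ} (hh : |h| < Real.pi) (hl : 0 ≤ l) :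
    arcPoint P Q h l - Q = l * cis h * (P - Q) / (1 + l * cis h) := by
  have := one_add_mul_cis_ne_zero hh hl
  rw [arcPoint]
  field_simp
  ring

lemma eq_arcPoint_iff {P Q : ℂ} {h l : ℝ} (hh : |h| < Real.pi) (hl : 0 ≤ l) {z : ℂ} :
    z = arcPoint P Q h l ↔ Q - z = -(l * cis h * (P - z)) := by
  have := one_add_mul_cis_ne_zero hh hl
  rw [arcPoint, eq_div_iff this]
  constructor <;> intro H <;> linear_combination -H

lemma mem_arcSet_iff {P Q : ℂ} {h : ℝ} (hh : |h| < Real.pi) {z : ℂ} :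
    z ∈ arcSet P Q h ↔ z = P ∨ ∃ l : ℝ, 0 ≤ l ∧ z = arcPoint P Q h l := by
  constructor
  · intro hz
    obtain ⟨s, hs, hz⟩ := notMem_slitPlane_iff.1 hz
    refine or_iff_not_imp_left.2 fun hzP => ?_
    have hPz : P - z ≠ 0 := sub_ne_zero.2 (Ne.symm hzP)
    have hn : (0 : ℝ) < Complex.normSq (P - z) := Complex.normSq_pos.2 hPz
    refine ⟨s / Complex.normSq (P - z), by positivity, ?_⟩
    rw [eq_arcPoint_iff hh (by positivity)]
    have h1 : (P - z) * conj (P - z) = (Complex.normSq (P - z) : ℂ) := Complex.mul_conj _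
    have h2 : (Complex.normSq (P - z) : ℂ) ≠ 0 := by exact_mod_cast hn.ne'
    have h3 := cis_mul_cis_neg h
    rw [arcForm] at hz
    push_cast
    have h4 : (Q - z) * (P - z) * conj (P - z) = -(s * cis h) * (P - z) := by
      linear_combination (cis h * (P - z)) * hz - (Q - z) * (P - z) * conj (P - z) * h3
    rw [mul_assoc, h1] at h4
    field_simp
    linear_combination h4
  · rintro (rfl | ⟨l, hl, hz⟩)
    · exact left_mem_arcSet _ _ _
    · rw [eq_arcPoint_iff hh hl] at hz
      refine notMem_slitPlane_iff.2
        ⟨l * Complex.normSq (P - z), mul_nonneg hl (Complex.normSq_nonneg _), ?_⟩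
      have h1 : (P - z) * conj (P - z) = (Complex.normSq (P - z) : ℂ) := Complex.mul_conj _
      have h3 := cis_mul_cis_neg h
      rw [arcForm, hz]
      push_cast
      rw [← h1]
      linear_combination (-l * (P - z) * conj (P - z)) * h3

namespace CircularArc

/-- Half of the signed angle swept by an arc; it is `0` for a segment. -/
noncomputable def halfSweep : CircularArc → ℝ
  | segment _ _ _ => 0
  | arc _ _ _ κ _ _ _ => κ / 2

lemma abs_halfSweep_lt (e : CircularArc) : |e.halfSweep| < Real.pi := by
  cases e with
  | segment p q hpq => simpa [halfSweep] using Real.pi_pos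
  | arc c r α κ hr hκ hκ' =>
    rw [halfSweep, abs_div, abs_two]
    linarith

lemma param_arc (c : ℂ) (r α κ : ℝ) (hr hκ hκ') (t : ℝ) :
    (arc c r α κ hr hκ hκ').param t = c + r * cis (α + t * κ) := by
  simp [param, circleMap, cis]

/-- For `|h| < π` the sine of `t h`, `t ∈ [0, 1]`, has the sign of `h`. -/
lemma sin_mul_mul_nonneg {h t : ℝ} (hh : |h| < Real.pi) (ht : t ∈ Icc (0 : ℝ) 1) :
    0 ≤ Real.sin (t * h) * h := by
  obtain ⟨h1, h2⟩ := abs_lt.1 hh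
  obtain ⟨h3, h4⟩ := ht
  rcases le_total 0 h with h0 | h0
  · exact mul_nonneg (Real.sin_nonneg_of_nonneg_of_le_pi (by positivity) (by nlinarith)) h0
  · exact mul_nonneg_of_nonpos_of_nonpos
      (Real.sin_nonpos_of_nonpos_of_neg_pi_le (by nlinarith) (by nlinarith)) h0

lemma sin_mul_self_pos {h : ℝ} (hh : |h| < Real.pi) (h0 : h ≠ 0) : 0 < Real.sin h * h := by
  obtain ⟨h1, h2⟩ := abs_lt.1 hh
  rcases h0.lt_or_gt with h0 | h0
  · exact mul_pos_of_neg_of_neg (Real.sin_neg_of_neg_of_neg_pi_lt h0 h1) h0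
  · exact mul_pos (Real.sin_pos_of_pos_of_lt_pi h0 h2) h0

lemma arc_finish_sub_param (c : ℂ) (r α κ t : ℝ) :
    (c + r * cis (α + 1 * κ)) - (c + r * cis (α + t * κ)) =
      r * (2 * Complex.I * Real.sin ((1 - t) * (κ / 2))) * cis (α + (1 + t) * (κ / 2)) := by
  have := cis_sub_cis (α + 1 * κ) (α + t * κ)
  rw [show (α + 1 * κ - (α + t * κ)) / 2 = (1 - t) * (κ / 2) by ring,
    show (α + 1 * κ + (α + t * κ)) / 2 = α + (1 + t) * (κ / 2) by ring] at this
  linear_combination (r : ℂ) * this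

lemma arc_start_sub_param (c : ℂ) (r α κ t : ℝ) :
    (c + r * cis (α + 0 * κ)) - (c + r * cis (α + t * κ)) =
      -(r * (2 * Complex.I * Real.sin (t * (κ / 2))) * cis (α + t * (κ / 2))) := by
  have := cis_sub_cis (α + 0 * κ) (α + t * κ)
  rw [show (α + 0 * κ - (α + t * κ)) / 2 = -(t * (κ / 2)) by ring,
    show (α + 0 * κ + (α + t * κ)) / 2 = α + t * (κ / 2) by ring, Real.sin_neg] at this
  push_cast at this ⊢
  linear_combination (r : ℂ) * this

/-- The arc as a level set: from its points, the two endpoints are seen under a constant angle. -/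
lemma carrier_eq_arcSet (e : CircularArc) : e.carrier = arcSet e.start e.finish e.halfSweep := by
  have hh := e.abs_halfSweep_lt
  cases e with
  | segment p q hpq =>
    simp only [halfSweep, abs_zero] at hh ⊢
    ext z
    simp only [start, finish, param, Complex.ofReal_zero, Complex.ofReal_one, zero_mul, one_mul,
      add_zero, add_sub_cancel]
    constructor
    · rintro ⟨t, ⟨ht0, ht1⟩, rfl⟩
      refine notMem_slitPlane_iff.2 ⟨(1 - t) * t * Complex.normSq (q - p),
        mul_nonneg (mul_nonneg (by linarith) ht0) (Complex.normSq_nonneg _), ?_⟩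
      have h1 : (q - p) * conj (q - p) = (Complex.normSq (q - p) : ℂ) := Complex.mul_conj _
      simp only [arcForm, param, neg_zero, cis_zero]
      push_cast
      rw [← h1]
      simp only [map_sub, map_add, map_mul, Complex.conj_ofReal]
      ring
    · rw [mem_arcSet_iff (by simpa using Real.pi_pos)]
      rintro (rfl | ⟨l, hl, rfl⟩)
      · exact ⟨0, by simp, by simp [param]⟩
      · refine ⟨1 / (1 + l), ⟨by positivity, ?_⟩, ?_⟩
        · rw [div_le_one (by positivity)]
          linarith
        · have : (1 : ℂ) + l ≠ 0 := by
            exact_mod_cast (by positivity : (1 : ℝ) + l ≠ 0)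
          simp only [param, arcPoint, cis_zero]
          push_cast
          field_simp
          ring
  | arc c r α κ hr hκ hκ' =>
    ext z
    simp only [halfSweep] at hh ⊢
    have hκ2 : κ / 2 ≠ 0 := by positivity
    simp only [start, finish, carrier, param_arc]
    constructor
    · rintro ⟨t, ht, rfl⟩
      have hsign : 0 ≤ Real.sin ((1 - t) * (κ / 2)) * Real.sin (t * (κ / 2)) := by
        have h1 := sin_mul_mul_nonneg hh ht
        have h2 := sin_mul_mul_nonneg hh (t := 1 - t) ⟨by linarith [ht.2], by linarith [ht.1]⟩
        have h3 : 0 < (κ / 2) ^ 2 := by positivity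
        by_contra hneg
        push Not at hneg
        nlinarith [mul_nonneg h2 h1, mul_pos_of_neg_of_neg hneg (neg_neg_of_pos h3)]
      refine notMem_slitPlane_iff.2
        ⟨4 * r ^ 2 * (Real.sin ((1 - t) * (κ / 2)) * Real.sin (t * (κ / 2))), by positivity, ?_⟩
      rw [arcForm, arc_finish_sub_param, arc_start_sub_param]
      simp only [map_neg, map_mul, Complex.conj_ofReal, Complex.conj_I, conj_cis, map_ofNat]
      have : cis (-(κ / 2)) * cis (α + (1 + t) * (κ / 2)) * cis (-(α + t * (κ / 2))) = 1 := by
        rw [← cis_add, ← cis_add, ← cis_zero]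
        congr 1
        ring
      push_cast
      linear_combination (4 * r ^ 2 * Complex.sin ((1 - t) * (κ / 2)) *
        Complex.sin (t * (κ / 2)) * Complex.I ^ 2) * this +
          (4 * r ^ 2 * Complex.sin ((1 - t) * (κ / 2)) * Complex.sin (t * (κ / 2))) *
            Complex.I_sq
    · rw [mem_arcSet_iff hh]
      rintro (rfl | ⟨l, hl, hz⟩)
      · exact ⟨0, by simp, by simp⟩
      · -- The parameter `t` of the point is a zero of `sin ((1 - t) h) - l sin (t h)`.
        have hcont : ContinuousOn
            (fun t : ℝ => (Real.sin ((1 - t) * (κ / 2)) - l * Real.sin (t * (κ / 2))) * (κ / 2))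
            (Icc 0 1) := by fun_prop
        have hpos := sin_mul_self_pos hh hκ2
        obtain ⟨t, ht, htz⟩ := intermediate_value_Icc' zero_le_one hcont (show (0 : ℝ) ∈ _ from
          ⟨by simp; nlinarith [mul_nonneg hl hpos.le], by simp; nlinarith⟩)
        have ht2 : Real.sin ((1 - t) * (κ / 2)) = l * Real.sin (t * (κ / 2)) := by
          have := (mul_eq_zero.1 htz).resolve_right hκ2
          linarith
        refine ⟨t, ht, ?_⟩
        change c + r * cis (α + t * κ) = z
        rw [hz, eq_arcPoint_iff hh hl, arc_finish_sub_param, arc_start_sub_param, ht2,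
          show α + (1 + t) * (κ / 2) = κ / 2 + (α + t * (κ / 2)) by ring, cis_add]
        push_cast
        ring

lemma start_ne_finish (e : CircularArc) : e.start ≠ e.finish := by
  have hh := e.abs_halfSweep_lt
  cases e with
  | segment p q hpq => simpa [start, finish, param] using hpq
  | arc c r α κ hr hκ hκ' =>
    simp only [halfSweep] at hh
    have h1 := arc_start_sub_param c r α κ 1
    have h2 := sin_mul_self_pos hh (by positivity)
    have h3 : (Real.sin (κ / 2) : ℂ) ≠ 0 := by
      intro h0
      rw [Complex.ofReal_eq_zero.1 h0] at h2
      simp at h2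
    have h4 : (r : ℂ) ≠ 0 := by exact_mod_cast hr.ne'
    simp only [start, finish, param_arc]
    rw [← sub_ne_zero, h1, one_mul]
    simp [h3, h4, cis_ne_zero, -Complex.ofReal_sin]

lemma hasDerivAt_param_arc (c : ℂ) (r α κ : ℝ) (hr hκ hκ') (t : ℝ) :
    HasDerivAt (arc c r α κ hr hκ hκ').param (r * (κ * Complex.I) * cis (α + t * κ)) t := by
  have h1 : HasDerivAt (fun t : ℝ => ((α + t * κ : ℝ) : ℂ) * Complex.I)
      (((κ : ℝ) : ℂ) * Complex.I) t := by
    have := (((hasDerivAt_id t).mul_const κ).const_add α).ofReal_comp.mul_const Complex.I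
    simpa using this
  have h2 := (h1.cexp.const_mul (r : ℂ)).const_add c
  rw [show (arc c r α κ hr hκ hκ').param = fun x => c + r * cis (α + x * κ) from
    funext (param_arc c r α κ hr hκ hκ')]
  refine h2.congr_deriv ?_
  simp only [cis]
  ring

/-- The tangent vectors at the endpoints, up to a positive factor, in terms of the endpoints and
the half sweep. -/
lemma exists_tangents_eq (e : CircularArc) : ∃ c : ℝ, 0 < c ∧
    e.tangentAtStart = c * ((e.finish - e.start) * cis (-e.halfSweep)) ∧
    e.tangentAtFinish = c * ((e.start - e.finish) * cis e.halfSweep) := by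
  have hh := e.abs_halfSweep_lt
  cases e with
  | segment p q hpq =>
    have hd (t : ℝ) : HasDerivAt (segment p q hpq).param (q - p) t := by
      have h1 := ((hasDerivAt_id t).ofReal_comp.mul_const (q - p)).const_add p
      rw [Complex.ofReal_one, one_mul] at h1
      exact h1
    refine ⟨1, one_pos, ?_, ?_⟩ <;>
      simp [tangentAtStart, tangentAtFinish, (hd _).deriv, start, finish, param, halfSweep,
        cis_zero]
  | arc c r α κ hr hκ hκ' =>
    simp only [halfSweep] at hh ⊢
    have h2 := sin_mul_self_pos hh (by positivity)
    have h3 : Real.sin (κ / 2) ≠ 0 := by rintro h0; simp [h0] at h2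
    have h4 : 0 < κ / 2 / Real.sin (κ / 2) := by
      rw [← mul_div_mul_left _ _ h3]
      exact div_pos h2 (mul_self_pos.2 h3)
    refine ⟨_, h4, ?_, ?_⟩
    · rw [tangentAtStart, (hasDerivAt_param_arc c r α κ hr hκ hκ' 0).deriv]
      simp only [start, finish, param_arc]
      rw [arc_finish_sub_param, sub_zero, one_mul,
        show α + (1 + 0) * (κ / 2) = (α + 0 * κ) + κ / 2 by ring, cis_add (α + 0 * κ) (κ / 2)]
      have h5 : (Real.sin (κ / 2) : ℂ) ≠ 0 := by exact_mod_cast h3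
      have h6 := cis_mul_cis_neg (κ / 2)
      generalize cis (κ / 2) = B at *
      generalize cis (-(κ / 2)) = C at *
      push_cast [-Complex.ofReal_sin]
      field_simp
      linear_combination (-(r * κ * cis (α + 0 * κ))) * h6
    · rw [tangentAtFinish, (hasDerivAt_param_arc c r α κ hr hκ hκ' 1).deriv]
      simp only [start, finish, param_arc]
      rw [arc_start_sub_param, one_mul, one_mul,
        show α + κ = (α + κ / 2) + κ / 2 by ring, cis_add (α + κ / 2)]
      have h5 : (Real.sin (κ / 2) : ℂ) ≠ 0 := by exact_mod_cast h3
      push_cast [-Complex.ofReal_sin]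
      field_simp

/-- Distinct endpoints and the half sweep can be prescribed. -/
lemma exists_eq {P Q : ℂ} (hPQ : P ≠ Q) {h : ℝ} (hh : |h| < Real.pi) :
    ∃ e : CircularArc, e.start = P ∧ e.finish = Q ∧ e.halfSweep = h := by
  by_cases h0 : h = 0
  · exact ⟨segment P Q hPQ, by simp [start, param], by simp [finish, param],
      by simp [halfSweep, h0]⟩
  · obtain ⟨h1, h2⟩ := abs_lt.1 hh
    have hne : cis (2 * h) - 1 ≠ 0 := by
      have := cis_sub_cis (2 * h) 0
      rw [cis_zero, sub_zero, add_zero, mul_div_cancel_left₀ h two_ne_zero] at this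
      rw [this]
      have hs : Real.sin h ≠ 0 := by
        intro hs
        have := sin_mul_self_pos hh h0
        simp [hs] at this
      have hs' : (Real.sin h : ℂ) ≠ 0 := by exact_mod_cast hs
      simp [hs', cis_ne_zero, -Complex.ofReal_sin]
    set d : ℂ := (Q - P) / (cis (2 * h) - 1) with hd
    have hd0 : d ≠ 0 := div_ne_zero (sub_ne_zero.2 hPQ.symm) hne
    have hd1 : d * cis (2 * h) = d + (Q - P) := by
      rw [hd]
      field_simp
      ring
    refine ⟨arc (P - d) ‖d‖ d.arg (2 * h) (norm_pos_iff.2 hd0) (by simpa using h0)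
      (by rw [abs_mul, abs_two]; linarith), ?_, ?_, ?_⟩
    · rw [start, param_arc, zero_mul, add_zero, cis_arg_mul_norm]
      ring
    · rw [finish, param_arc, one_mul, cis_add, ← mul_assoc, cis_arg_mul_norm, hd1]
      ring
    · simp [halfSweep]

end CircularArc

/-! ### Directions at a point that lead into a set -/

/-- The direction `u` leads from `P` into `S`: all points `P + r x` with small `r > 0` and `x` close
to `u` lie in `S`. -/
def DirIn (S : Set ℂ) (P u : ℂ) : Prop :=
  ∀ᶠ x : ℝ × ℂ in 𝓝[>] 0 ×ˢ 𝓝 u, P + x.1 * x.2 ∈ S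

/-- `S` is a union of connected components of the complement of `B`. -/
def Saturated (B S : Set ℂ) : Prop :=
  ∀ K : Set ℂ, IsPreconnected K → K ⊆ Bᶜ → (K ∩ S).Nonempty → K ⊆ S

lemma DirIn.inter {S S' : Set ℂ} {P u : ℂ} (h : DirIn S P u) (h' : DirIn S' P u) :
    DirIn (S ∩ S') P u := Eventually.and h h'

lemma DirIn.eventually {S : Set ℂ} {P u : ℂ} (h : DirIn S P u) {ι : Type*} {l : Filter ι}
    {f : ι → ℝ} {x : ι → ℂ} (hf : Tendsto f l (𝓝[>] 0)) (hx : Tendsto x l (𝓝 u)) :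
    ∀ᶠ i in l, P + f i * x i ∈ S :=
  (hf.prodMk hx).eventually h

lemma DirIn.ray {S : Set ℂ} {P u : ℂ} (h : DirIn S P u) :
    ∀ᶠ r : ℝ in 𝓝[>] 0, P + r * u ∈ S :=
  h.eventually tendsto_id tendsto_const_nhds

lemma isOpen_setOf_dirIn (S : Set ℂ) (P : ℂ) : IsOpen {u | DirIn S P u} := by
  rw [isOpen_iff_eventually]
  intro u hu
  obtain ⟨pa, ha, pb, hb, hab⟩ := eventually_prod_iff.1 hu
  filter_upwards [eventually_eventually_nhds.2 hb] with v hv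
  exact eventually_prod_iff.2 ⟨pa, ha, pb, hv, hab⟩

lemma tendsto_mul_const_nhdsGT_zero {c : ℝ} (hc : 0 < c) :
    Tendsto (fun r : ℝ => r * c) (𝓝[>] 0) (𝓝[>] 0) := by
  refine tendsto_nhdsWithin_iff.2 ⟨?_, ?_⟩
  · have : Tendsto (fun r : ℝ => r * c) (𝓝 0) (𝓝 (0 * c)) := tendsto_id.mul_const c
    rw [zero_mul] at this
    exact this.mono_left nhdsWithin_le_nhds
  · filter_upwards [self_mem_nhdsWithin] with r hr
    exact mul_pos hr hc

lemma eventually_ray_mul {S : Set ℂ} {P u : ℂ} {c : ℝ} (hc : 0 < c)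
    (h : ∀ᶠ r : ℝ in 𝓝[>] 0, P + r * u ∈ S) : ∀ᶠ r : ℝ in 𝓝[>] 0, P + r * (c * u) ∈ S := by
  filter_upwards [(tendsto_mul_const_nhdsGT_zero hc).eventually h] with r hr
  convert hr using 1
  push_cast
  ring

lemma DirIn.smul {S : Set ℂ} {P u : ℂ} {c : ℝ} (hc : 0 < c) (h : DirIn S P u) :
    DirIn S P (c * u) := by
  have h1 : Tendsto (fun x : ℝ × ℂ => x.1 * c) (𝓝[>] 0 ×ˢ 𝓝 (c * u)) (𝓝[>] 0) :=
    (tendsto_mul_const_nhdsGT_zero hc).comp tendsto_fst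
  have h2 : Tendsto (fun x : ℝ × ℂ => (c : ℂ)⁻¹ * x.2) (𝓝[>] 0 ×ˢ 𝓝 (c * u)) (𝓝 u) := by
    have hc' : (c : ℂ) ≠ 0 := by exact_mod_cast hc.ne'
    have : Tendsto (fun x : ℝ × ℂ => (c : ℂ)⁻¹ * x.2) (𝓝[>] 0 ×ˢ 𝓝 (c * u))
        (𝓝 ((c : ℂ)⁻¹ * (c * u))) := tendsto_snd.const_mul _
    rwa [inv_mul_cancel_left₀ hc'] at this
  filter_upwards [h.eventually h1 h2] with x hx
  have hc' : (c : ℂ) ≠ 0 := by exact_mod_cast hc.ne'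
  convert hx using 2
  push_cast
  field_simp

/-- A direction into the complement of `B` leads into a single component of it. -/
lemma Saturated.dirIn {B S : Set ℂ} (hS : Saturated B S) {P u : ℂ} (hu : DirIn Bᶜ P u)
    (hf : ∃ᶠ r : ℝ in 𝓝[>] 0, P + r * u ∈ S) : DirIn S P u := by
  obtain ⟨U, hU, V, hV, hUV⟩ := mem_prod_iff.1 hu
  obtain ⟨ρ, hρ, hρU⟩ := (mem_nhdsGT_iff_exists_Ioo_subset (a := (0 : ℝ))).1 hU
  obtain ⟨δ, hδ, hδV⟩ := Metric.mem_nhds_iff.1 hV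
  set K : Set ℂ := (fun x : ℝ × ℂ => P + x.1 * x.2) '' (Ioo 0 ρ ×ˢ Metric.ball u δ) with hK
  have hKc : IsPreconnected K :=
    (isPreconnected_Ioo.prod (convex_ball u δ).isPreconnected).image _ (by fun_prop)
  have hKB : K ⊆ Bᶜ := by
    rintro _ ⟨x, hx, rfl⟩
    exact hUV ⟨hρU hx.1, hδV hx.2⟩
  have hIoo : Ioo (0 : ℝ) ρ ∈ 𝓝[>] (0 : ℝ) := Ioo_mem_nhdsGT hρ
  obtain ⟨r, hrS, hr⟩ := (hf.and_eventually hIoo).exists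
  have hKS : K ⊆ S := hS K hKc hKB ⟨_, ⟨(r, u), ⟨hr, Metric.mem_ball_self hδ⟩, rfl⟩, hrS⟩
  filter_upwards [prod_mem_prod hIoo (Metric.ball_mem_nhds u hδ)] with x hx
  exact hKS ⟨x, hx, rfl⟩

lemma Saturated.diff {B S : Set ℂ} (hS : Saturated B S) : Saturated B (Bᶜ \ S) := by
  intro K hK hKB hne z hz
  refine ⟨hKB hz, fun hzS => ?_⟩
  obtain ⟨y, hy, hyB, hyS⟩ := hne
  exact hyS (hS K hK hKB ⟨z, hz, hzS⟩ hy)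

lemma Saturated.dirIn_diff {B S : Set ℂ} (hS : Saturated B S) {P u : ℂ} (hu : DirIn Bᶜ P u)
    (hn : ¬ DirIn S P u) : DirIn (Bᶜ \ S) P u := by
  refine hS.diff.dirIn hu (Eventually.frequently ?_)
  have h1 : ¬ ∃ᶠ r : ℝ in 𝓝[>] 0, P + r * u ∈ S := fun h => hn (hS.dirIn hu h)
  filter_upwards [not_frequently.1 h1, hu.ray] with r hr hr'
  exact ⟨hr', hr⟩

/-- Directions that can be joined through directions into the complement of `B` lead into the same
component of it. -/
lemma Saturated.dirIn_of_isPreconnected {B S : Set ℂ} (hS : Saturated B S) {P : ℂ} {D : Set ℂ}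
    (hD : IsPreconnected D) (hfree : ∀ u ∈ D, DirIn Bᶜ P u) {u₀ u : ℂ} (hu₀ : u₀ ∈ D)
    (h₀ : DirIn S P u₀) (hu : u ∈ D) : DirIn S P u := by
  have hdisj : Disjoint {u | DirIn S P u} {u | DirIn (Bᶜ \ S) P u} := by
    rw [Set.disjoint_left]
    intro x hx hx'
    obtain ⟨r, hr, hr'⟩ := ((DirIn.ray hx).and (DirIn.ray hx')).exists
    exact hr'.2 hr
  refine hD.subset_left_of_subset_union (isOpen_setOf_dirIn _ _) (isOpen_setOf_dirIn _ _) hdisj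
    (fun x hx => ?_) ⟨u₀, hu₀, h₀⟩ hu
  by_cases hxS : DirIn S P x
  · exact Or.inl hxS
  · exact Or.inr (hS.dirIn_diff (hfree x hx) hxS)

lemma dirIn_compl_of_notMem {B : Set ℂ} (hB : IsClosed B) {P : ℂ} (hP : P ∉ B) (u : ℂ) :
    DirIn Bᶜ P u := by
  have h1 : Tendsto (fun x : ℝ × ℂ => P + x.1 * x.2) (𝓝[>] 0 ×ˢ 𝓝 u) (𝓝 P) := by
    have : Tendsto (fun x : ℝ × ℂ => P + x.1 * x.2) (𝓝 (0, u)) (𝓝 (P + ((0 : ℝ) : ℂ) * u)) :=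
      Continuous.tendsto (by fun_prop) (0, u)
    rw [nhds_prod_eq] at this
    simp only [Complex.ofReal_zero, zero_mul, add_zero] at this
    exact this.mono_left (prod_mono nhdsWithin_le_nhds le_rfl)
  exact h1.eventually (hB.isOpen_compl.mem_nhds hP)

/-- Used for a form that vanishes at an endpoint `P` of an arc: its value at `P + r x` is
`r F (r, x)`, and `F (0, u)` decides whether the direction `u` leads away from the arc. -/
lemma eventually_mem_slitPlane {F : ℝ × ℂ → ℂ} {u : ℂ} (hF : Continuous F)
    (h : F (0, u) ∈ Complex.slitPlane) :
    ∀ᶠ x : ℝ × ℂ in 𝓝[>] 0 ×ˢ 𝓝 u, (x.1 : ℂ) * F x ∈ Complex.slitPlane := by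
  have h1 : ∀ᶠ x : ℝ × ℂ in 𝓝[>] 0 ×ˢ 𝓝 u, F x ∈ Complex.slitPlane := by
    have := hF.continuousAt.eventually (Complex.isOpen_slitPlane.mem_nhds h)
    rw [nhds_prod_eq] at this
    exact this.filter_mono (prod_mono nhdsWithin_le_nhds le_rfl)
  have h2 : ∀ᶠ x : ℝ × ℂ in 𝓝[>] 0 ×ˢ 𝓝 u, 0 < x.1 :=
    tendsto_fst.eventually self_mem_nhdsWithin
  filter_upwards [h1, h2] with x hx hx0
  exact (ofReal_mul_mem_slitPlane hx0).2 hx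

lemma arcForm_left_add (P Q : ℂ) (h r : ℝ) (x : ℂ) :
    arcForm P Q h (P + r * x) = r * -(cis (-h) * (Q - P - r * x) * conj x) := by
  simp only [arcForm, map_sub, map_add, map_mul, Complex.conj_ofReal]
  ring

lemma arcForm_right_add (P Q : ℂ) (h r : ℝ) (x : ℂ) :
    arcForm P Q h (Q + r * x) = r * -(cis (-h) * x * conj (P - Q - r * x)) := by
  simp only [arcForm, map_sub, map_add, map_mul, Complex.conj_ofReal]
  ring

lemma dirIn_compl_arcSet_left {P Q u : ℂ} {h : ℝ}
    (hu : -((Q - P) * cis (-h) * conj u) ∈ Complex.slitPlane) : DirIn (arcSet P Q h)ᶜ P u := by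
  have hF : Continuous fun x : ℝ × ℂ => -(cis (-h) * (Q - P - x.1 * x.2) * conj x.2) := by
    have : Continuous fun x : ℝ × ℂ => conj x.2 := Complex.continuous_conj.comp continuous_snd
    fun_prop
  have := eventually_mem_slitPlane (u := u) hF (by
    convert hu using 1
    simp only [Complex.ofReal_zero]
    ring)
  filter_upwards [this] with x hx
  rw [mem_compl_iff, arcSet, mem_ofPred_eq, not_not, arcForm_left_add]
  exact hx

lemma dirIn_compl_arcSet_right {P Q u : ℂ} {h : ℝ}
    (hu : -(u * conj ((P - Q) * cis h)) ∈ Complex.slitPlane) : DirIn (arcSet P Q h)ᶜ Q u := by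
  have hF : Continuous fun x : ℝ × ℂ => -(cis (-h) * x.2 * conj (P - Q - x.1 * x.2)) := by
    have : Continuous fun x : ℝ × ℂ => conj (P - Q - x.1 * x.2) :=
      Complex.continuous_conj.comp (by fun_prop)
    fun_prop
  have := eventually_mem_slitPlane (u := u) hF (by
    convert hu using 1
    simp only [Complex.ofReal_zero, map_mul, conj_cis, zero_mul, sub_zero]
    ring)
  filter_upwards [this] with x hx
  rw [mem_compl_iff, arcSet, mem_ofPred_eq, not_not, arcForm_right_add]
  exact hx

lemma tendsto_arcPoint_direction_left {P Q : ℂ} {h : ℝ} :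
    Tendsto (fun r : ℝ => (Q - P) / (r + cis h)) (𝓝[>] 0) (𝓝 ((Q - P) * cis (-h))) := by
  have h0 : ((0 : ℝ) : ℂ) + cis h ≠ 0 := by simpa using cis_ne_zero h
  have h1 : ContinuousAt (fun r : ℝ => (Q - P) / (r + cis h)) 0 :=
    continuousAt_const.div (by fun_prop) h0
  have h2 : (Q - P) / (((0 : ℝ) : ℂ) + cis h) = (Q - P) * cis (-h) := by
    rw [div_eq_iff h0]
    simp [mul_assoc, cis_neg_mul_cis]
  have h3 := h1.tendsto
  rw [h2] at h3
  exact h3.mono_left nhdsWithin_le_nhds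

lemma tendsto_arcPoint_direction_right {P Q : ℂ} {h : ℝ} :
    Tendsto (fun r : ℝ => (P - Q) * cis h / (1 + r * cis h)) (𝓝[>] 0) (𝓝 ((P - Q) * cis h)) := by
  have h1 : ContinuousAt (fun r : ℝ => (P - Q) * cis h / (1 + r * cis h)) 0 :=
    continuousAt_const.div (by fun_prop) (by simp)
  have h3 := h1.tendsto
  simp only [Complex.ofReal_zero, zero_mul, add_zero, div_one] at h3
  exact h3.mono_left nhdsWithin_le_nhds

lemma DirIn.exists_arcPoint_left {S : Set ℂ} {P Q : ℂ} {h : ℝ} (hh : |h| < Real.pi)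
    (hS : DirIn S P ((Q - P) * cis (-h))) : ∃ l > 0, arcPoint P Q h l ∈ S := by
  obtain ⟨r, hr, hr0⟩ := ((hS.eventually tendsto_id tendsto_arcPoint_direction_left).and
    self_mem_nhdsWithin).exists
  have hr0 : 0 < r := hr0
  refine ⟨r⁻¹, by positivity, ?_⟩
  convert hr using 1
  have h1 := one_add_mul_cis_ne_zero hh (inv_pos.2 hr0).le
  have h2 : (r : ℂ) ≠ 0 := by exact_mod_cast hr0.ne'
  have h3 : (r : ℂ) + cis h ≠ 0 := by
    intro h4
    apply h1
    rw [Complex.ofReal_inv]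
    field_simp
    rw [h4, mul_zero]
  rw [← sub_eq_iff_eq_add', arcPoint_sub_left hh (inv_pos.2 hr0).le, id]
  rw [Complex.ofReal_inv] at h1 ⊢
  field_simp

lemma DirIn.exists_arcPoint_right {S : Set ℂ} {P Q : ℂ} {h : ℝ} (hh : |h| < Real.pi)
    (hS : DirIn S Q ((P - Q) * cis h)) : ∃ l > 0, arcPoint P Q h l ∈ S := by
  obtain ⟨r, hr, hr0⟩ := ((hS.eventually tendsto_id tendsto_arcPoint_direction_right).and
    self_mem_nhdsWithin).exists
  have hr0 : 0 < r := hr0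
  refine ⟨r, hr0, ?_⟩
  convert hr using 1
  rw [← sub_eq_iff_eq_add', arcPoint_sub_right hh hr0.le, id]
  ring

lemma isPreconnected_image_arcPoint (P Q : ℂ) {h : ℝ} (hh : |h| < Real.pi) :
    IsPreconnected (arcPoint P Q h '' Ioi 0) := by
  refine isPreconnected_Ioi.image _ fun l hl => ContinuousAt.continuousWithinAt ?_
  have := one_add_mul_cis_ne_zero hh (le_of_lt hl)
  unfold arcPoint
  exact ContinuousAt.div (by fun_prop) (by fun_prop) this

/-- An arc that avoids `B` except at its endpoints transports sides from one endpoint to the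
other. -/
lemma Saturated.dirIn_iff_of_arc {B S : Set ℂ} (hS : Saturated B S) {P Q : ℂ} {h : ℝ}
    (hh : |h| < Real.pi) (harc : ∀ l > 0, arcPoint P Q h l ∉ B)
    (hP : DirIn Bᶜ P ((Q - P) * cis (-h))) (hQ : DirIn Bᶜ Q ((P - Q) * cis h)) :
    DirIn S P ((Q - P) * cis (-h)) ↔ DirIn S Q ((P - Q) * cis h) := by
  have hK := isPreconnected_image_arcPoint P Q hh
  have hKB : arcPoint P Q h '' Ioi 0 ⊆ Bᶜ := by
    rintro _ ⟨l, hl, rfl⟩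
    exact harc l hl
  -- If the direction at the other end led elsewhere, the arc would meet both `S` and `Bᶜ \ S`.
  constructor
  · intro H
    by_contra hn
    obtain ⟨l, hl, hlS⟩ := H.exists_arcPoint_left hh
    obtain ⟨m, hm, hmS⟩ := (hS.dirIn_diff hQ hn).exists_arcPoint_right hh
    exact hmS.2 (hS _ hK hKB ⟨_, ⟨l, hl, rfl⟩, hlS⟩ ⟨m, hm, rfl⟩)
  · intro H
    by_contra hn
    obtain ⟨l, hl, hlS⟩ := H.exists_arcPoint_right hh
    obtain ⟨m, hm, hmS⟩ := (hS.dirIn_diff hP hn).exists_arcPoint_left hh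
    exact hmS.2 (hS _ hK hKB ⟨_, ⟨l, hl, rfl⟩, hlS⟩ ⟨m, hm, rfl⟩)

/-! ### Two arcs with a common endpoint -/

lemma cis_mem_slitPlane_of_ne {t : ℝ} (ht : cis t ≠ -1) : cis t ∈ Complex.slitPlane := by
  by_contra h
  obtain ⟨s, hs, h⟩ := notMem_slitPlane_iff.1 h
  have h1 := norm_cis t
  rw [h, norm_neg, Complex.norm_real, Real.norm_of_nonneg hs] at h1
  rw [h1] at h
  exact ht (by simpa using h)

lemma arg_cis_mul {t : ℝ} {z : ℂ} (hz : z ≠ 0) (ht : t + z.arg ∈ Ioc (-Real.pi) Real.pi) :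
    (cis t * z).arg = t + z.arg := by
  conv_lhs => rw [← cis_arg_mul_norm z, mul_left_comm, ← cis_add,
    Complex.arg_real_mul _ (norm_pos_iff.2 hz), arg_cis ht]

lemma abs_arg_lt_pi {z : ℂ} (hz : z ∈ Complex.slitPlane) : |z.arg| < Real.pi :=
  abs_lt.2 ⟨Complex.neg_pi_lt_arg z,
    lt_of_le_of_ne (Complex.arg_le_pi z) (Complex.slitPlane_arg_ne_pi hz)⟩

lemma conj_mem_slitPlane {z : ℂ} : conj z ∈ Complex.slitPlane ↔ z ∈ Complex.slitPlane := by
  simp [Complex.mem_slitPlane_iff]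

lemma arcSet_symm (P Q : ℂ) (h : ℝ) : arcSet P Q h = arcSet Q P (-h) := by
  ext z
  have : arcForm Q P (-h) z = conj (arcForm P Q h z) := by
    simp only [arcForm, map_mul, conj_cis, Complex.conj_conj]
    ring
  rw [arcSet, arcSet, mem_ofPred_eq, mem_ofPred_eq, this, conj_mem_slitPlane]

lemma arcForm_add (P Q : ℂ) (h η : ℝ) (z : ℂ) :
    arcForm P Q (h + η) z = cis (-η) * arcForm P Q h z := by
  rw [arcForm, neg_add, cis_add, arcForm]
  ring

lemma arcPoint_ne_left {P Q : ℂ} (hPQ : P ≠ Q) {h l : ℝ} (hh : |h| < Real.pi) (hl : 0 ≤ l) :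
    arcPoint P Q h l ≠ P := by
  rw [← sub_ne_zero, arcPoint_sub_left hh hl]
  exact div_ne_zero (sub_ne_zero.2 hPQ.symm) (one_add_mul_cis_ne_zero hh hl)

lemma arcPoint_ne_right {P Q : ℂ} (hPQ : P ≠ Q) {h l : ℝ} (hh : |h| < Real.pi) (hl : 0 < l) :
    arcPoint P Q h l ≠ Q := by
  rw [← sub_ne_zero, arcPoint_sub_right hh hl.le]
  have : (l : ℂ) ≠ 0 := by exact_mod_cast hl.ne'
  exact div_ne_zero (mul_ne_zero (mul_ne_zero this (cis_ne_zero h)) (sub_ne_zero.2 hPQ))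
    (one_add_mul_cis_ne_zero hh hl.le)

/-- Arcs with the same endpoints and different sweeps meet only in the endpoints. -/
lemma arcPoint_notMem_arcSet_add {P Q : ℂ} (hPQ : P ≠ Q) {h η l : ℝ} (hh : |h + η| < Real.pi)
    (hη : cis η ≠ 1) (hl : 0 < l) : arcPoint P Q (h + η) l ∉ arcSet P Q h := by
  intro hmem
  have h1 : arcPoint P Q (h + η) l ∈ arcSet P Q (h + η) :=
    (mem_arcSet_iff hh).2 (Or.inr ⟨l, hl.le, rfl⟩)
  obtain ⟨s, hs, h2⟩ := notMem_slitPlane_iff.1 h1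
  obtain ⟨t, ht, h3⟩ := notMem_slitPlane_iff.1 hmem
  rw [arcForm_add, h3] at h2
  have ht0 : t ≠ 0 := by
    rintro rfl
    rw [Complex.ofReal_zero, neg_zero, arcForm] at h3
    have h4 := sub_ne_zero.2 (arcPoint_ne_right hPQ hh hl).symm
    have h5 := sub_ne_zero.2 (arcPoint_ne_left hPQ hh hl.le).symm
    exact mul_ne_zero (mul_ne_zero (cis_ne_zero _) h4)
      ((map_ne_zero (starRingEnd ℂ)).2 h5) h3
  have h4 : (t : ℂ) = s * cis η := by
    linear_combination (-cis η) * h2 - t * cis_neg_mul_cis η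
  have h5 : t = s := by
    have := congrArg norm h4
    rwa [norm_mul, norm_cis, mul_one, Complex.norm_real, Complex.norm_real,
      Real.norm_of_nonneg hs, Real.norm_of_nonneg ht] at this
  rw [← h5] at h4
  have h6 : (t : ℂ) ≠ 0 := by exact_mod_cast ht0
  exact hη (mul_left_cancel₀ h6 (by rw [← h4, mul_one]))

/-- Whether `0` is a combination of `1`, `e^{-ia}` and `e^{ib}` with nonnegative coefficients, that
of `1` being positive. -/
lemma exists_one_add_cis_eq_zero_iff {a b : ℝ} (ha : |a| < Real.pi) (hb : |b| < Real.pi) :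
    (∃ l m : ℝ, 0 ≤ l ∧ 0 ≤ m ∧ 1 + l * cis (-a) + m * cis b = 0) ↔ Real.pi < |a + b| := by
  obtain ⟨ha1, ha2⟩ := abs_lt.1 ha
  obtain ⟨hb1, hb2⟩ := abs_lt.1 hb
  constructor
  · rintro ⟨l, m, hl, hm, h0⟩
    have hre := congrArg Complex.re h0
    have him := congrArg Complex.im h0
    simp only [Complex.add_re, Complex.one_re, Complex.re_ofReal_mul, cis_re, Real.cos_neg,
      Complex.zero_re] at hre
    simp only [Complex.add_im, Complex.one_im, Complex.im_ofReal_mul, cis_im, Real.sin_neg,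
      Complex.zero_im] at him
    by_contra hcon
    push Not at hcon
    obtain ⟨hs1, hs2⟩ := abs_le.1 hcon
    have e1 : Real.sin (a + b) = _ := Real.sin_add a b
    have key1 : Real.sin b + l * Real.sin (a + b) = 0 := by
      rw [e1]
      linear_combination Real.sin b * hre - Real.cos b * him
    have key2 : Real.sin a + m * Real.sin (a + b) = 0 := by
      rw [e1]
      linear_combination Real.sin a * hre + Real.cos a * him
    rcases le_total 0 (a + b) with hsum | hsum
    · have h3 := Real.sin_nonneg_of_nonneg_of_le_pi hsum hs2
      have h4 : b ≤ 0 := by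
        by_contra hb0
        have := Real.sin_pos_of_pos_of_lt_pi (not_le.1 hb0) hb2
        nlinarith [mul_nonneg hl h3]
      have h5 : a ≤ 0 := by
        by_contra ha0
        have := Real.sin_pos_of_pos_of_lt_pi (not_le.1 ha0) ha2
        nlinarith [mul_nonneg hm h3]
      obtain rfl : a = 0 := by linarith
      obtain rfl : b = 0 := by linarith
      simp at hre
      linarith
    · have h3 := Real.sin_nonpos_of_nonpos_of_neg_pi_le hsum hs1
      have h4 : 0 ≤ b := by
        by_contra hb0
        have := Real.sin_neg_of_neg_of_neg_pi_lt (not_le.1 hb0) hb1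
        nlinarith [mul_nonneg hl (neg_nonneg.2 h3)]
      have h5 : 0 ≤ a := by
        by_contra ha0
        have := Real.sin_neg_of_neg_of_neg_pi_lt (not_le.1 ha0) ha1
        nlinarith [mul_nonneg hm (neg_nonneg.2 h3)]
      obtain rfl : a = 0 := by linarith
      obtain rfl : b = 0 := by linarith
      simp at hre
      linarith
  · intro hab
    have key : Real.sin (a + b) ≠ 0 ∧ 0 ≤ -Real.sin b / Real.sin (a + b) ∧
        0 ≤ -Real.sin a / Real.sin (a + b) := by
      rcases lt_abs.1 hab with hab | hab
      · have h1 : Real.sin (a + b) < 0 := by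
          rw [← neg_pos, ← Real.sin_sub_pi]
          exact Real.sin_pos_of_pos_of_lt_pi (by linarith) (by linarith)
        have h2 := Real.sin_pos_of_pos_of_lt_pi (by linarith : 0 < a) ha2
        have h3 := Real.sin_pos_of_pos_of_lt_pi (by linarith : 0 < b) hb2
        exact ⟨h1.ne, div_nonneg_of_nonpos (by linarith) h1.le,
          div_nonneg_of_nonpos (by linarith) h1.le⟩
      · have h1 : 0 < Real.sin (a + b) := by
          rw [← Real.sin_add_two_pi]
          exact Real.sin_pos_of_pos_of_lt_pi (by linarith) (by linarith)
        have h2 := Real.sin_neg_of_neg_of_neg_pi_lt (by linarith : a < 0) ha1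
        have h3 := Real.sin_neg_of_neg_of_neg_pi_lt (by linarith : b < 0) hb1
        exact ⟨h1.ne', div_nonneg (by linarith) h1.le, div_nonneg (by linarith) h1.le⟩
    obtain ⟨h1, h2, h3⟩ := key
    refine ⟨_, _, h2, h3, ?_⟩
    apply Complex.ext
    · simp only [Complex.add_re, Complex.one_re, Complex.re_ofReal_mul, cis_re, Real.cos_neg,
        Complex.zero_re]
      field_simp
      rw [Real.sin_add]
      ring
    · simp only [Complex.add_im, Complex.one_im, Complex.im_ofReal_mul, cis_im, Real.sin_neg,
        Complex.zero_im]
      field_simp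
      ring

/-- Seen from the common endpoint `V` by an inversion, two arcs become two half lines that start at
the images of their other endpoints. -/
lemma exists_mem_arcSet_iff {V P Q : ℂ} {h k : ℝ} (hh : |h| < Real.pi) (hk : |k| < Real.pi)
    (hVP : V ≠ P) :
    (∃ z ≠ V, z ∈ arcSet V P h ∧ z ∈ arcSet Q V k) ↔
      ∃ l m : ℝ, 0 ≤ l ∧ 0 ≤ m ∧
        (P - Q) + l * (cis h * (V - Q)) - m * (cis (-k) * (V - P)) = 0 := by
  have hk' : |-k| < Real.pi := by rwa [abs_neg]
  rw [arcSet_symm Q V k]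
  simp only [mem_arcSet_iff hh, mem_arcSet_iff hk']
  constructor
  · rintro ⟨z, hzV, h1, h2⟩
    obtain ⟨l, hl, hz⟩ := h1.resolve_left hzV
    obtain ⟨m, hm, hz'⟩ := h2.resolve_left hzV
    rw [eq_arcPoint_iff hh hl] at hz
    rw [eq_arcPoint_iff hk' hm] at hz'
    refine ⟨l, m, hl, hm, ?_⟩
    have e1 : V - P = (1 + l * cis h) * (V - z) := by linear_combination -hz
    have e2 : V - Q = (1 + m * cis (-k)) * (V - z) := by linear_combination -hz'
    have e3 : P - Q = (m * cis (-k) - l * cis h) * (V - z) := by linear_combination hz - hz'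
    rw [e1, e2, e3]
    ring
  · rintro ⟨l, m, hl, hm, h0⟩
    refine ⟨arcPoint V P h l, arcPoint_ne_left hVP hh hl, Or.inr ⟨l, hl, rfl⟩,
      Or.inr ⟨m, hm, ?_⟩⟩
    rw [eq_arcPoint_iff hk' hm]
    have h1 := one_add_mul_cis_ne_zero hh hl
    rw [arcPoint]
    field_simp
    linear_combination -h0

/-- The arguments `a`, `b` of the two forms measure how far the arcs turn away from the circle
through `V`, `P`, `Q`; the arcs leave `V` without meeting again iff `|a + b| ≤ π`. -/
lemma arcSet_inter_eq_singleton_iff {V P Q : ℂ} {h k : ℝ} (hh : |h| < Real.pi)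
    (hk : |k| < Real.pi) (hA : arcForm V P h Q ∈ Complex.slitPlane)
    (hB : arcForm Q V k P ∈ Complex.slitPlane) :
    arcSet V P h ∩ arcSet Q V k = {V} ↔
      |(arcForm V P h Q).arg + (arcForm Q V k P).arg| ≤ Real.pi := by
  set A := arcForm V P h Q with hAdef
  set B := arcForm Q V k P with hBdef
  have hA0 := Complex.slitPlane_ne_zero hA
  have hB0 := Complex.slitPlane_ne_zero hB
  have hPQ : P ≠ Q := by
    rintro rfl
    simp [hAdef, arcForm] at hA0
  have hVP : V ≠ P := by
    rintro rfl
    simp [hBdef, arcForm] at hB0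
  have hargA := abs_arg_lt_pi hA
  have hargB := abs_arg_lt_pi hB
  have hinter : arcSet V P h ∩ arcSet Q V k = {V} ↔
      ¬ ∃ z ≠ V, z ∈ arcSet V P h ∧ z ∈ arcSet Q V k := by
    push Not
    constructor
    · intro H z hz h1 h2
      exact hz (H ▸ ⟨h1, h2⟩ : z ∈ ({V} : Set ℂ))
    · intro H
      ext z
      constructor
      · rintro ⟨h1, h2⟩
        by_contra hz
        exact H z hz h1 h2
      · rintro rfl
        exact ⟨left_mem_arcSet _ _ _, right_mem_arcSet _ _ _⟩
  rw [hinter, exists_mem_arcSet_iff hh hk hVP, ← not_lt,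
    ← exists_one_add_cis_eq_zero_iff hargA hargB, not_iff_not]
  have hn : (P - Q) * conj (P - Q) = (Complex.normSq (P - Q) : ℂ) := Complex.mul_conj _
  have hn0 : (0 : ℝ) < Complex.normSq (P - Q) := Complex.normSq_pos.2 (sub_ne_zero.2 hPQ)
  have hn0' : (Complex.normSq (P - Q) : ℂ) ≠ 0 := by exact_mod_cast hn0.ne'
  have hc0 : conj (P - Q) ≠ 0 := (map_ne_zero (starRingEnd ℂ)).2 (sub_ne_zero.2 hPQ)
  have hnA : (0 : ℝ) < ‖A‖ := norm_pos_iff.2 hA0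
  have hnB : (0 : ℝ) < ‖B‖ := norm_pos_iff.2 hB0
  have eA : (‖A‖ : ℂ) * cis (-A.arg) = cis h * (V - Q) * conj (P - Q) := by
    have := congrArg conj (cis_arg_mul_norm A)
    rw [map_mul, conj_cis, Complex.conj_ofReal] at this
    rw [this, hAdef, arcForm]
    simp only [map_mul, conj_cis, neg_neg, Complex.conj_conj]
    ring
  have eB : (‖B‖ : ℂ) * cis B.arg = -(cis (-k) * (V - P) * conj (P - Q)) := by
    rw [cis_arg_mul_norm, hBdef, arcForm]
    simp only [map_sub]
    ring
  constructor
  · rintro ⟨l, m, hl, hm, h0⟩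
    refine ⟨l * ‖A‖ / Complex.normSq (P - Q), m * ‖B‖ / Complex.normSq (P - Q), by positivity,
      by positivity, ?_⟩
    push_cast
    field_simp
    linear_combination (conj (P - Q)) * h0 + l * eA + m * eB - hn
  · rintro ⟨l, m, hl, hm, h0⟩
    refine ⟨l * Complex.normSq (P - Q) / ‖A‖, m * Complex.normSq (P - Q) / ‖B‖, by positivity,
      by positivity, ?_⟩
    have hnA' : (‖A‖ : ℂ) ≠ 0 := by exact_mod_cast hnA.ne'
    have hnB' : (‖B‖ : ℂ) ≠ 0 := by exact_mod_cast hnB.ne'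
    apply mul_right_cancel₀ hc0
    have e1 : cis (-A.arg) = cis h * (V - Q) * conj (P - Q) / ‖A‖ := by
      rw [eq_div_iff hnA', ← eA]; ring
    have e2 : cis B.arg = -(cis (-k) * (V - P) * conj (P - Q)) / ‖B‖ := by
      rw [eq_div_iff hnB', ← eB]; ring
    rw [e1, e2] at h0
    push_cast
    rw [zero_mul]
    field_simp at h0 ⊢
    linear_combination (Complex.normSq (P - Q) : ℂ) * h0 + ‖A‖ * ‖B‖ * hn

/-- The angle at the common endpoint of two arcs, in terms of the arguments `a`, `b` of the two
forms: the tangent of the second arc arises from that of the first by a turn through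
`π - (a + b)`. -/
lemma exists_tangent_right_eq {V P Q : ℂ} {h k : ℝ} (hA : arcForm V P h Q ≠ 0)
    (hB : arcForm Q V k P ≠ 0) : ∃ c : ℝ, 0 < c ∧
    (Q - V) * cis k = c * (cis (Real.pi - ((arcForm V P h Q).arg + (arcForm Q V k P).arg)) *
      ((P - V) * cis (-h))) := by
  have hPQ : P ≠ Q := by
    rintro rfl
    simp [arcForm] at hA
  have hVP : V ≠ P := by
    rintro rfl
    simp [arcForm] at hB
  have hP0 : P - V ≠ 0 := sub_ne_zero.2 hVP.symm
  have hn : (P - Q) * conj (P - Q) = (Complex.normSq (P - Q) : ℂ) := Complex.mul_conj _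
  have hm : (P - V) * conj (P - V) = (Complex.normSq (P - V) : ℂ) := Complex.mul_conj _
  have hn0 : (0 : ℝ) < Complex.normSq (P - Q) := Complex.normSq_pos.2 (sub_ne_zero.2 hPQ)
  have hm0 : (0 : ℝ) < Complex.normSq (P - V) := Complex.normSq_pos.2 hP0
  have hn0' : (Complex.normSq (P - Q) : ℂ) ≠ 0 := by exact_mod_cast hn0.ne'
  have hm0' : (Complex.normSq (P - V) : ℂ) ≠ 0 := by exact_mod_cast hm0.ne'
  have hnA : (0 : ℝ) < ‖arcForm V P h Q‖ := norm_pos_iff.2 hA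
  have hnB : (0 : ℝ) < ‖arcForm Q V k P‖ := norm_pos_iff.2 hB
  refine ⟨‖arcForm V P h Q‖ * ‖arcForm Q V k P‖ /
    (Complex.normSq (P - Q) * Complex.normSq (P - V)), by positivity, ?_⟩
  have eA : (‖arcForm V P h Q‖ : ℂ) * cis (-(arcForm V P h Q).arg) =
      cis h * (V - Q) * conj (P - Q) := by
    have := congrArg conj (cis_arg_mul_norm (arcForm V P h Q))
    rw [map_mul, conj_cis, Complex.conj_ofReal] at this
    rw [this, arcForm]
    simp only [map_mul, conj_cis, neg_neg, Complex.conj_conj]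
    ring
  have eB : (‖arcForm Q V k P‖ : ℂ) * cis (-(arcForm Q V k P).arg) =
      cis k * conj (V - P) * (Q - P) := by
    have := congrArg conj (cis_arg_mul_norm (arcForm Q V k P))
    rw [map_mul, conj_cis, Complex.conj_ofReal] at this
    rw [this, arcForm]
    simp only [map_mul, conj_cis, neg_neg, Complex.conj_conj]
  generalize (arcForm V P h Q).arg = a at *
  generalize (arcForm Q V k P).arg = b at *
  rw [show Real.pi - (a + b) = Real.pi + (-a + -b) by ring, cis_add, cis_pi, cis_add]
  push_cast
  field_simp
  have e3 : (‖arcForm V P h Q‖ : ℂ) * ‖arcForm Q V k P‖ * (cis (-a) * cis (-b)) =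
      (cis h * (V - Q) * conj (P - Q)) * (cis k * conj (V - P) * (Q - P)) := by
    rw [← eA, ← eB]
    ring
  have e4 : conj (V - P) = -conj (P - V) := by simp
  rw [e4] at e3
  linear_combination (cis (-h) * (P - V)) * e3 - (Q - V) * cis k * (P - Q) * conj (P - Q) *
    conj (P - V) * (P - V) * cis_mul_cis_neg h -
    (Q - V) * cis k * Complex.normSq (P - V) * hn - (Q - V) * cis k * (P - Q) * conj (P - Q) * hm

/-! ### The combinatorics of an arc-triangle -/

lemma fin_three_add_one_add_one (i : Fin 3) : i + 1 + 1 = i + 2 := by revert i; decide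

lemma fin_three_add_two_add_one (i : Fin 3) : i + 2 + 1 = i := by revert i; decide

lemma fin_three_add_one_add_two (i : Fin 3) : i + 1 + 2 = i := by revert i; decide

lemma fin_three_add_two_add_two (i : Fin 3) : i + 2 + 2 = i + 1 := by revert i; decide

lemma fin_three_sum_eq {M : Type*} [AddCommMonoid M] (f : Fin 3 → M) (i : Fin 3) :
    ∑ j, f j = f i + f (i + 1) + f (i + 2) := by
  rw [Fin.sum_univ_three]
  fin_cases i
  · rfl
  · exact (add_rotate (f 0) (f 1) (f 2))
  · exact (add_rotate (f 2) (f 0) (f 1)).symm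

lemma cis_ne_one {t : ℝ} (h0 : t ≠ 0) (h : |t| < 2 * Real.pi) : cis t ≠ 1 := by
  intro h1
  obtain ⟨n, hn⟩ := cis_eq_one_iff.1 h1
  have hn0 : n ≠ 0 := by
    rintro rfl
    simp at hn
    exact h0 hn
  have h2 : (1 : ℝ) ≤ |(n : ℝ)| := by exact_mod_cast Int.one_le_abs hn0
  rw [hn, abs_mul, abs_of_pos Real.two_pi_pos] at h
  nlinarith [Real.two_pi_pos]

lemma cis_ne_neg_one {t : ℝ} (h : |t| < Real.pi) : cis t ≠ -1 := by
  intro h1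
  have := cis_mem_slitPlane h
  rw [h1] at this
  norm_num [Complex.mem_slitPlane_iff] at this

lemma neg_cis (t : ℝ) : -cis t = cis (t - Real.pi) := by
  rw [sub_eq_add_neg, cis_add, show cis (-Real.pi) = -1 by simp [cis, Complex.exp_neg]]
  ring

namespace ArcTriangle

/-- Half of the signed angle swept by the edge from `vertex i` to `vertex (i + 1)`. -/
noncomputable def half (T : ArcTriangle) (i : Fin 3) : ℝ := (T.edge i).halfSweep

/-- The direction in which `edge i` leaves `vertex i`. -/
noncomputable def startDir (T : ArcTriangle) (i : Fin 3) : ℂ :=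
  (T.vertex (i + 1) - T.vertex i) * cis (-T.half i)

/-- The direction in which the preceding edge `edge (i + 2)`, followed backwards, leaves
`vertex i`. -/
noncomputable def finishDir (T : ArcTriangle) (i : Fin 3) : ℂ :=
  (T.vertex (i + 2) - T.vertex i) * cis (T.half (i + 2))

/-- The form of `edge i`, evaluated at the opposite vertex. -/
noncomputable def oppForm (T : ArcTriangle) (i : Fin 3) : ℂ :=
  arcForm (T.vertex i) (T.vertex (i + 1)) (T.half i) (T.vertex (i + 2))

/-- The signed angle between `edge i` and the circle through the three vertices. -/
noncomputable def deviation (T : ArcTriangle) (i : Fin 3) : ℝ := (T.oppForm i).arg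

/-- The sum of the deviations of the two edges at `vertex i`. The angle on the left of the boundary
at `vertex i` is `π - T.turn i`. -/
noncomputable def turn (T : ArcTriangle) (i : Fin 3) : ℝ := T.deviation i + T.deviation (i + 2)

variable {T : ArcTriangle}

lemma abs_half_lt (T : ArcTriangle) (i : Fin 3) : |T.half i| < Real.pi :=
  (T.edge i).abs_halfSweep_lt

lemma carrier_edge (T : ArcTriangle) (i : Fin 3) :
    (T.edge i).carrier = arcSet (T.vertex i) (T.vertex (i + 1)) (T.half i) := by
  rw [CircularArc.carrier_eq_arcSet, T.start_edge, T.finish_edge, half]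

lemma vertex_ne (T : ArcTriangle) (i : Fin 3) : T.vertex i ≠ T.vertex (i + 1) := by
  rw [← T.start_edge, ← T.finish_edge]
  exact (T.edge i).start_ne_finish

lemma startDir_ne_zero (T : ArcTriangle) (i : Fin 3) : T.startDir i ≠ 0 :=
  mul_ne_zero (sub_ne_zero.2 (T.vertex_ne i).symm) (cis_ne_zero _)

lemma oppForm_add_one (T : ArcTriangle) (i : Fin 3) : T.oppForm (i + 1) =
    arcForm (T.vertex (i + 1)) (T.vertex (i + 2)) (T.half (i + 1)) (T.vertex i) := by
  rw [oppForm, fin_three_add_one_add_one, fin_three_add_one_add_two]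

lemma oppForm_add_two (T : ArcTriangle) (i : Fin 3) : T.oppForm (i + 2) =
    arcForm (T.vertex (i + 2)) (T.vertex i) (T.half (i + 2)) (T.vertex (i + 1)) := by
  rw [oppForm, fin_three_add_two_add_one, fin_three_add_two_add_two]

lemma carrier_edge_add_one (T : ArcTriangle) (i : Fin 3) : (T.edge (i + 1)).carrier =
    arcSet (T.vertex (i + 1)) (T.vertex (i + 2)) (T.half (i + 1)) := by
  rw [carrier_edge, fin_three_add_one_add_one]

lemma carrier_edge_add_two (T : ArcTriangle) (i : Fin 3) : (T.edge (i + 2)).carrier =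
    arcSet (T.vertex (i + 2)) (T.vertex i) (T.half (i + 2)) := by
  rw [carrier_edge, fin_three_add_two_add_one]

lemma turn_add_one (T : ArcTriangle) (i : Fin 3) :
    T.turn (i + 1) = T.deviation (i + 1) + T.deviation i := by
  rw [turn, fin_three_add_one_add_two]

lemma Simple.oppForm_mem (hT : T.Simple) (i : Fin 3) : T.oppForm i ∈ Complex.slitPlane := by
  by_contra h
  have h1 : T.vertex (i + 2) ∈ (T.edge i).carrier := by
    rw [carrier_edge]
    exact h
  have h2 : T.vertex (i + 2) ∈ (T.edge (i + 1)).carrier := by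
    rw [carrier_edge_add_one]
    exact right_mem_arcSet _ _ _
  have h3 : T.vertex (i + 2) ∈ ({T.vertex (i + 1)} : Set ℂ) := hT i ▸ ⟨h1, h2⟩
  have h4 := T.vertex_ne (i + 1)
  rw [fin_three_add_one_add_one] at h4
  exact h4 h3.symm

lemma edge_inter_eq_iff (hopp : ∀ i, T.oppForm i ∈ Complex.slitPlane) (i : Fin 3) :
    (T.edge (i + 2)).carrier ∩ (T.edge i).carrier = {T.vertex i} ↔ |T.turn i| ≤ Real.pi := by
  have h1 := hopp (i + 2)
  rw [oppForm_add_two] at h1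
  rw [inter_comm, carrier_edge_add_two, carrier_edge,
    arcSet_inter_eq_singleton_iff (T.abs_half_lt i) (T.abs_half_lt (i + 2)) (hopp i) h1,
    turn, deviation, deviation, oppForm_add_two, oppForm]

lemma Simple.abs_turn_le (hT : T.Simple) (i : Fin 3) : |T.turn i| ≤ Real.pi := by
  have h := hT (i + 2)
  rw [fin_three_add_two_add_one] at h
  exact (edge_inter_eq_iff hT.oppForm_mem i).1 h

/-- An arc-triangle is simple if no edge passes through the opposite vertex and the deviations of
adjacent edges have a sum in `[-π, π]`. -/
lemma simple_of_abs_turn_le (hopp : ∀ i, T.oppForm i ∈ Complex.slitPlane)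
    (hturn : ∀ i, |T.turn i| ≤ Real.pi) : T.Simple := by
  intro i
  have h := (edge_inter_eq_iff hopp (i + 1)).2 (hturn (i + 1))
  rwa [fin_three_add_one_add_two] at h

lemma boundary_eq (T : ArcTriangle) (i : Fin 3) : T.boundary =
    arcSet (T.vertex i) (T.vertex (i + 1)) (T.half i) ∪
      (arcSet (T.vertex (i + 1)) (T.vertex (i + 2)) (T.half (i + 1)) ∪
        arcSet (T.vertex (i + 2)) (T.vertex i) (T.half (i + 2))) := by
  rw [← carrier_edge, ← carrier_edge_add_one, ← carrier_edge_add_two, boundary]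
  ext z
  simp only [mem_iUnion, mem_union]
  constructor
  · rintro ⟨j, hj⟩
    have : j = i ∨ j = i + 1 ∨ j = i + 2 := by clear hj; revert i j; decide
    rcases this with rfl | rfl | rfl <;> simp [hj]
  · rintro (h | h | h) <;> exact ⟨_, h⟩

lemma connectedComponentIn_eq_of_preconnected {B K : Set ℂ} (hK : IsPreconnected K) (hKB : K ⊆ Bᶜ)
    {y z : ℂ} (hy : y ∈ K) (hz : z ∈ K) :
    connectedComponentIn Bᶜ y = connectedComponentIn Bᶜ z :=
  connectedComponentIn_eq (hK.subset_connectedComponentIn hy hKB hz)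

lemma saturated_inside (T : ArcTriangle) : Saturated T.boundary T.inside := by
  rintro K hK hKB ⟨z, hz, hzi⟩ y hy
  refine ⟨hKB hy, ?_⟩
  rw [connectedComponentIn_eq_of_preconnected hK hKB hy hz]
  exact hzi.2

lemma saturated_outside (T : ArcTriangle) : Saturated T.boundary T.outside := by
  rintro K hK hKB ⟨z, hz, hzi⟩ y hy
  refine ⟨hKB hy, ?_⟩
  rw [connectedComponentIn_eq_of_preconnected hK hKB hy hz]
  exact hzi.2

lemma not_dirIn_inside_and_outside {P u : ℂ} (h1 : DirIn T.inside P u) (h2 : DirIn T.outside P u) :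
    False := by
  obtain ⟨r, hr, hr'⟩ := (h1.ray.and h2.ray).exists
  exact hr'.2 hr.2

/-! ### Directions at the vertices -/

lemma exists_finishDir_eq (hopp : ∀ i, T.oppForm i ∈ Complex.slitPlane) (i : Fin 3) :
    ∃ c : ℝ, 0 < c ∧ T.finishDir i = c * (cis (Real.pi - T.turn i) * T.startDir i) := by
  have h1 := Complex.slitPlane_ne_zero (hopp (i + 2))
  rw [oppForm_add_two] at h1
  obtain ⟨c, hc, h⟩ := exists_tangent_right_eq (Complex.slitPlane_ne_zero (hopp i)) h1
  refine ⟨c, hc, ?_⟩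
  rw [finishDir, h, turn, deviation, deviation, oppForm_add_two, oppForm, startDir]

/-- The leading coefficient at `vertex i`, in the direction `cis t * T.startDir i`, of the form of
the edge that starts there. -/
lemma neg_startDir_mul_conj (T : ArcTriangle) (i : Fin 3) (t : ℝ) :
    -((T.vertex (i + 1) - T.vertex i) * cis (-T.half i) * conj (cis t * T.startDir i)) =
      (Complex.normSq (T.startDir i) : ℝ) * cis (Real.pi - t) := by
  have hn : T.startDir i * conj (T.startDir i) = (Complex.normSq (T.startDir i) : ℂ) :=
    Complex.mul_conj _
  rw [sub_eq_add_neg Real.pi, cis_add, cis_pi, ← hn, map_mul, conj_cis, ← startDir]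
  ring

/-- The leading coefficient at `vertex i`, in the direction `cis t * T.startDir i`, of the form of
the edge that ends there. -/
lemma exists_neg_mul_conj_finishDir (hopp : ∀ i, T.oppForm i ∈ Complex.slitPlane) (i : Fin 3)
    (t : ℝ) : ∃ c : ℝ, 0 < c ∧ -(cis t * T.startDir i *
      conj ((T.vertex (i + 2) - T.vertex i) * cis (T.half (i + 2)))) = c * cis (t + T.turn i) := by
  obtain ⟨c, hc, hfin⟩ := exists_finishDir_eq hopp i
  have hn : T.startDir i * conj (T.startDir i) = (Complex.normSq (T.startDir i) : ℂ) :=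
    Complex.mul_conj _
  have hn0 : (0 : ℝ) < Complex.normSq (T.startDir i) :=
    Complex.normSq_pos.2 (T.startDir_ne_zero i)
  refine ⟨c * Complex.normSq (T.startDir i), by positivity, ?_⟩
  rw [← finishDir, hfin, map_mul, map_mul, conj_cis, Complex.conj_ofReal, Complex.ofReal_mul,
    ← hn, cis_add, show -(Real.pi - T.turn i) = T.turn i - Real.pi by ring, ← neg_cis]
  ring

/-- A direction at a vertex that is tangent to neither of the two edges there leads away from the
boundary. -/
lemma dirIn_compl_boundary_startDir (hopp : ∀ i, T.oppForm i ∈ Complex.slitPlane) (i : Fin 3)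
    {t : ℝ} (h1 : cis t ≠ 1) (h2 : cis (t + T.turn i) ≠ -1) :
    DirIn T.boundaryᶜ (T.vertex i) (cis t * T.startDir i) := by
  rw [T.boundary_eq i, compl_union, compl_union]
  refine DirIn.inter (dirIn_compl_arcSet_left ?_) (DirIn.inter ?_ (dirIn_compl_arcSet_right ?_))
  · rw [neg_startDir_mul_conj,
      ofReal_mul_mem_slitPlane (Complex.normSq_pos.2 (T.startDir_ne_zero i))]
    refine cis_mem_slitPlane_of_ne fun h => h1 ?_
    have h3 := cis_add t (Real.pi - t)
    rw [h, add_sub_cancel, cis_pi] at h3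
    linear_combination h3
  · refine dirIn_compl_of_notMem (isClosed_arcSet _ _ _) ?_ _
    have := hopp (i + 1)
    rw [oppForm_add_one] at this
    exact fun h => h this
  · obtain ⟨c, hc, he⟩ := exists_neg_mul_conj_finishDir hopp i t
    rw [he, ofReal_mul_mem_slitPlane hc]
    exact cis_mem_slitPlane_of_ne h2

lemma dirIn_compl_boundary_finishDir (hopp : ∀ i, T.oppForm i ∈ Complex.slitPlane) (i : Fin 3)
    {t : ℝ} (h1 : cis t ≠ 1) (h2 : cis (t - T.turn i) ≠ -1) :
    DirIn T.boundaryᶜ (T.vertex i) (cis t * T.finishDir i) := by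
  obtain ⟨c, hc, hfin⟩ := exists_finishDir_eq hopp i
  have := (dirIn_compl_boundary_startDir hopp i (t := t + (Real.pi - T.turn i)) (fun h => h2 (by
    have h3 := neg_cis (t - T.turn i + 2 * Real.pi)
    rw [show t - T.turn i + 2 * Real.pi - Real.pi = t + (Real.pi - T.turn i) by ring, h, cis_add,
      cis_two_pi, mul_one] at h3
    rw [← h3, neg_neg])) (fun h => h1 (by
    rw [show t + (Real.pi - T.turn i) + T.turn i = t + Real.pi by ring, cis_add, cis_pi] at h
    linear_combination -h))).smul hc
  rw [hfin]
  convert this using 1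
  rw [cis_add]
  ring

/-- The sides of `edge i` are the same at both of its ends, as seen on an arc with a slightly
different sweep: that arc does not meet the boundary if the deviations, changed accordingly, still
satisfy the inequalities for a simple arc-triangle. -/
lemma dirIn_startDir_iff_finishDir (hopp : ∀ i, T.oppForm i ∈ Complex.slitPlane) {S : Set ℂ}
    (hS : Saturated T.boundary S) {i : Fin 3} {η : ℝ} (hη : cis η ≠ 1)
    (h1 : |T.half i + η| < Real.pi) (h2 : |T.deviation i - η| < Real.pi)
    (h3 : |T.turn i - η| < Real.pi) (h4 : |T.turn (i + 1) - η| < Real.pi) :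
    DirIn S (T.vertex i) (cis (-η) * T.startDir i) ↔
      DirIn S (T.vertex (i + 1)) (cis η * T.finishDir (i + 1)) := by
  have hη' : cis (-η) ≠ 1 := by
    intro h
    have := cis_neg_mul_cis η
    rw [h, one_mul] at this
    exact hη this
  have hne := T.vertex_ne i
  have hs : cis (-η) * T.startDir i =
      (T.vertex (i + 1) - T.vertex i) * cis (-(T.half i + η)) := by
    rw [neg_add, cis_add, startDir]
    ring
  have hf : cis η * T.finishDir (i + 1) =
      (T.vertex i - T.vertex (i + 1)) * cis (T.half i + η) := by
    rw [cis_add, finishDir, fin_three_add_one_add_two]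
    ring
  have hfree1 := dirIn_compl_boundary_startDir hopp i hη' (cis_ne_neg_one (by
    rwa [neg_add_eq_sub]))
  have hfree2 := dirIn_compl_boundary_finishDir hopp (i + 1) hη (cis_ne_neg_one (by
    rwa [abs_sub_comm]))
  rw [hs] at hfree1 ⊢
  rw [hf] at hfree2 ⊢
  refine hS.dirIn_iff_of_arc h1 (fun l hl hmem => ?_) hfree1 hfree2
  have hp : arcPoint (T.vertex i) (T.vertex (i + 1)) (T.half i + η) l ∈
      arcSet (T.vertex i) (T.vertex (i + 1)) (T.half i + η) :=
    (mem_arcSet_iff h1).2 (Or.inr ⟨l, hl.le, rfl⟩)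
  have harg : (arcForm (T.vertex i) (T.vertex (i + 1)) (T.half i + η) (T.vertex (i + 2))).arg =
      T.deviation i - η := by
    rw [arcForm_add, ← oppForm, arg_cis_mul (Complex.slitPlane_ne_zero (hopp i)), neg_add_eq_sub,
      deviation]
    rw [neg_add_eq_sub]
    exact ⟨(abs_lt.1 h2).1, (abs_lt.1 h2).2.le⟩
  have hmem' : arcForm (T.vertex i) (T.vertex (i + 1)) (T.half i + η) (T.vertex (i + 2)) ∈
      Complex.slitPlane := by
    rw [Complex.mem_slitPlane_iff_arg, harg, arcForm_add]
    exact ⟨(abs_lt.1 h2).2.ne, mul_ne_zero (cis_ne_zero _) (Complex.slitPlane_ne_zero (hopp i))⟩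
  rw [T.boundary_eq i] at hmem
  rcases hmem with h | h | h
  · exact arcPoint_notMem_arcSet_add hne h1 hη hl h
  · have hA := hopp (i + 1)
    rw [oppForm_add_one] at hA
    have := (arcSet_inter_eq_singleton_iff (T.abs_half_lt (i + 1)) h1 hA hmem').2 (by
      rw [harg, ← oppForm_add_one, ← deviation]
      rw [turn_add_one] at h4
      rw [← add_sub_assoc]
      exact h4.le)
    have h5 := this.subset ⟨h, hp⟩
    exact arcPoint_ne_right hne h1 hl h5
  · have hB := hopp (i + 2)
    rw [oppForm_add_two] at hB
    have := (arcSet_inter_eq_singleton_iff h1 (T.abs_half_lt (i + 2)) hmem' hB).2 (by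
      rw [harg, ← oppForm_add_two, ← deviation]
      rw [turn] at h3
      rw [sub_add_eq_add_sub]
      exact h3.le)
    have h5 := this.subset ⟨hp, h⟩
    exact arcPoint_ne_left hne h1 hl.le h5

/-! ### Interior angles -/

lemma Sweeps.smul {v u w : ℂ} {θ : ℝ} (h : T.Sweeps v u w θ) {c c' : ℝ} (hc : 0 < c)
    (hc' : 0 < c') : T.Sweeps v (c * u) (c' * w) θ := by
  obtain ⟨h1, h2, h3⟩ := h
  refine ⟨?_, fun t ht => ?_, fun t ht => ?_⟩
  · have := (h1.pos_smul_left hc).pos_smul_right hc'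
    rw [Complex.real_smul, Complex.real_smul] at this
    convert this using 1
    ring
  · rw [mul_left_comm]
    exact eventually_ray_mul hc (h2 t ht)
  · rw [mul_left_comm]
    exact eventually_ray_mul hc (h3 t ht)

lemma sweeps_smul_iff {v u w : ℂ} {θ : ℝ} {c c' : ℝ} (hc : 0 < c) (hc' : 0 < c') :
    T.Sweeps v (c * u) (c' * w) θ ↔ T.Sweeps v u w θ := by
  refine ⟨fun h => ?_, fun h => h.smul hc hc'⟩
  have := h.smul (inv_pos.2 hc) (inv_pos.2 hc')
  have e1 : (c : ℂ) ≠ 0 := by exact_mod_cast hc.ne'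
  have e2 : (c' : ℂ) ≠ 0 := by exact_mod_cast hc'.ne'
  rwa [Complex.ofReal_inv, Complex.ofReal_inv, inv_mul_cancel_left₀ e1,
    inv_mul_cancel_left₀ e2] at this

lemma isInteriorAngle_iff (T : ArcTriangle) (i : Fin 3) (θ : ℝ) : T.IsInteriorAngle i θ ↔
    θ ∈ Icc 0 (2 * Real.pi) ∧ (T.Sweeps (T.vertex i) (T.startDir i) (T.finishDir i) θ ∨
      T.Sweeps (T.vertex i) (T.finishDir i) (T.startDir i) θ) := by
  obtain ⟨c, hc, h1, -⟩ := (T.edge i).exists_tangents_eq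
  obtain ⟨c', hc', -, h2⟩ := (T.edge (i + 2)).exists_tangents_eq
  rw [T.start_edge, T.finish_edge, ← half, ← startDir] at h1
  rw [T.start_edge, T.finish_edge, ← half, fin_three_add_two_add_one, ← finishDir] at h2
  rw [IsInteriorAngle, h1, h2, sweeps_smul_iff hc hc', sweeps_smul_iff hc' hc]

/-! ### Realizable angles satisfy the inequalities -/

/-- At `vertex i`, the directions close to the two edges on the left of the boundary lead into `S`,
and those on the right lead into `S'`, except that nothing is claimed for a side on which the edges
form a cusp, so that only an angle `0` is left between their tangents. -/
def SidesAt (T : ArcTriangle) (S S' : Set ℂ) (i : Fin 3) : Prop :=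
  (T.turn i < Real.pi → ∀ᶠ η : ℝ in 𝓝[>] 0, DirIn S (T.vertex i) (cis η * T.startDir i) ∧
    DirIn S (T.vertex i) (cis (-η) * T.finishDir i)) ∧
  (-Real.pi < T.turn i → ∀ᶠ η : ℝ in 𝓝[>] 0, DirIn S' (T.vertex i) (cis (-η) * T.startDir i) ∧
    DirIn S' (T.vertex i) (cis η * T.finishDir i))

lemma Sweeps.ray_inside {v u w : ℂ} {θ c : ℝ} (h : T.Sweeps v u w θ) (hc : 0 < c)
    (hw : w = c * (cis θ * u)) {η : ℝ} (hη : η ∈ Ioo 0 θ) :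
    (∀ᶠ r : ℝ in 𝓝[>] 0, v + r * (cis η * u) ∈ T.inside) ∧
      ∀ᶠ r : ℝ in 𝓝[>] 0, v + r * (cis (-η) * w) ∈ T.inside := by
  refine ⟨h.2.1 η hη, ?_⟩
  have h1 := eventually_ray_mul hc (h.2.1 (θ - η) ⟨by linarith [hη.2], by linarith [hη.1]⟩)
  have e : cis (-η) * w = c * (cis (θ - η) * u) := by
    rw [hw, sub_eq_neg_add, cis_add]
    ring
  rw [e]
  exact h1

lemma Sweeps.ray_outside {v u w : ℂ} {θ c : ℝ} (h : T.Sweeps v u w θ) (hc : 0 < c)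
    (hw : w = c * (cis θ * u)) {η : ℝ} (hη : η ∈ Ioo 0 (2 * Real.pi - θ)) :
    (∀ᶠ r : ℝ in 𝓝[>] 0, v + r * (cis (-η) * u) ∈ T.outside) ∧
      ∀ᶠ r : ℝ in 𝓝[>] 0, v + r * (cis η * w) ∈ T.outside := by
  have h2 := h.2.2 (2 * Real.pi - η) ⟨by linarith [hη.2], by linarith [hη.1]⟩
  have h1 := eventually_ray_mul hc (h.2.2 (θ + η) ⟨by linarith [hη.1], by linarith [hη.2]⟩)
  have e : cis η * w = c * (cis (θ + η) * u) := by
    rw [hw, cis_add]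
    ring
  rw [e]
  refine ⟨?_, h1⟩
  have e2 : cis (-η) = cis (2 * Real.pi - η) := by
    rw [sub_eq_add_neg, cis_add, cis_two_pi, one_mul]
  rw [e2]
  exact h2

lemma eventually_mem_Ioo_nhdsGT {a : ℝ} (ha : 0 < a) : ∀ᶠ η : ℝ in 𝓝[>] 0, η ∈ Ioo 0 a :=
  Ioo_mem_nhdsGT ha

/-- For `SidesAt` it suffices to know single rays, because directions close to the two edges lead
away from the boundary and hence into a single component of its complement. -/
lemma sidesAt_of_rays (hT : T.Simple) {S S' : Set ℂ} (hS : Saturated T.boundary S)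
    (hS' : Saturated T.boundary S') (i : Fin 3)
    (hleft : ∀ η ∈ Ioo 0 (Real.pi - T.turn i),
      (∀ᶠ r : ℝ in 𝓝[>] 0, T.vertex i + r * (cis η * T.startDir i) ∈ S) ∧
      ∀ᶠ r : ℝ in 𝓝[>] 0, T.vertex i + r * (cis (-η) * T.finishDir i) ∈ S)
    (hright : ∀ η ∈ Ioo 0 (Real.pi + T.turn i),
      (∀ᶠ r : ℝ in 𝓝[>] 0, T.vertex i + r * (cis (-η) * T.startDir i) ∈ S') ∧
      ∀ᶠ r : ℝ in 𝓝[>] 0, T.vertex i + r * (cis η * T.finishDir i) ∈ S') :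
    T.SidesAt S S' i := by
  obtain ⟨hs1, hs2⟩ := abs_le.1 (hT.abs_turn_le i)
  have hne : ∀ η ∈ Ioo 0 Real.pi, cis η ≠ 1 ∧ cis (-η) ≠ 1 := fun η hη =>
    ⟨cis_ne_one hη.1.ne' (abs_lt.2 ⟨by linarith [hη.1, Real.pi_pos], by linarith [hη.2, hη.1]⟩),
      cis_ne_one (neg_ne_zero.2 hη.1.ne')
        (abs_lt.2 ⟨by linarith [hη.1, hη.2], by linarith [hη.1, hη.2]⟩)⟩
  constructor
  · intro hs
    filter_upwards [eventually_mem_Ioo_nhdsGT Real.pi_pos,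
      eventually_mem_Ioo_nhdsGT (sub_pos.2 hs)] with η h1 h2
    refine ⟨hS.dirIn ?_ (hleft η h2).1.frequently, hS.dirIn ?_ (hleft η h2).2.frequently⟩
    · exact dirIn_compl_boundary_startDir hT.oppForm_mem i (hne η h1).1
        (cis_ne_neg_one (abs_lt.2 ⟨by linarith [h2.1], by linarith [h2.2]⟩))
    · exact dirIn_compl_boundary_finishDir hT.oppForm_mem i (hne η h1).2
        (cis_ne_neg_one (abs_lt.2 ⟨by linarith [h2.2], by linarith [h2.1]⟩))
  · intro hs
    filter_upwards [eventually_mem_Ioo_nhdsGT Real.pi_pos,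
      eventually_mem_Ioo_nhdsGT (by linarith : 0 < Real.pi + T.turn i)] with η h1 h2
    refine ⟨hS'.dirIn ?_ (hright η h2).1.frequently, hS'.dirIn ?_ (hright η h2).2.frequently⟩
    · exact dirIn_compl_boundary_startDir hT.oppForm_mem i (hne η h1).2
        (cis_ne_neg_one (abs_lt.2 ⟨by linarith [h2.2], by linarith [h2.1]⟩))
    · exact dirIn_compl_boundary_finishDir hT.oppForm_mem i (hne η h1).1
        (cis_ne_neg_one (abs_lt.2 ⟨by linarith [h2.1], by linarith [h2.2]⟩))

/-- A rotation that maps `u` into the ray of a positive multiple of `cis s * u` turns by `s` modulo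
`2π`. -/
lemma exists_int_of_sameRay {θ s c : ℝ} {u w : ℂ} (hu : u ≠ 0) (hc : 0 < c)
    (hw : w = c * (cis s * u)) (h : SameRay ℝ (Complex.exp (θ * Complex.I) * u) w) :
    ∃ n : ℤ, θ - s = n * (2 * Real.pi) := by
  change SameRay ℝ (cis θ * u) w at h
  have hc' : (c : ℂ) ≠ 0 := by exact_mod_cast hc.ne'
  have hw0 : w ≠ 0 := hw ▸ mul_ne_zero hc' (mul_ne_zero (cis_ne_zero s) hu)
  obtain ⟨a, b, ha, hb, hab⟩ := h.exists_pos (mul_ne_zero (cis_ne_zero θ) hu) hw0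
  rw [Complex.real_smul, Complex.real_smul, hw] at hab
  have h1 : (a : ℂ) * cis θ = b * c * cis s := by
    apply mul_right_cancel₀ hu
    linear_combination hab
  have h2 : a = b * c := by
    have := congrArg norm h1
    simpa [norm_cis, abs_of_pos ha, abs_of_pos hb, abs_of_pos hc] using this
  have ha' : (a : ℂ) ≠ 0 := by exact_mod_cast ha.ne'
  have h3 : cis θ = cis s := by
    apply mul_left_cancel₀ ha'
    rw [h1, h2]
    push_cast
    ring
  refine cis_eq_one_iff.1 ?_
  rw [sub_eq_add_neg, cis_add, h3, cis_mul_cis_neg]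

/-- If `θ` is the interior angle at `vertex i`, then the interior lies on the left and
`θ = π - turn i`, or the interior lies on the right and `θ = π + turn i`. -/
lemma IsInteriorAngle.eq_and_sidesAt (hT : T.Simple) {i : Fin 3} {θ : ℝ}
    (h : T.IsInteriorAngle i θ) :
    (θ = Real.pi - T.turn i ∧ T.SidesAt T.inside T.outside i) ∨
      (θ = Real.pi + T.turn i ∧ T.SidesAt T.outside T.inside i) := by
  obtain ⟨⟨hθ0, hθ1⟩, h⟩ := (isInteriorAngle_iff T i θ).1 h
  obtain ⟨hs1, hs2⟩ := abs_le.1 (hT.abs_turn_le i)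
  have hpi := Real.pi_pos
  obtain ⟨c, hc, hw⟩ := exists_finishDir_eq hT.oppForm_mem i
  have hc' : (c : ℂ) ≠ 0 := by exact_mod_cast hc.ne'
  have hu : T.startDir i = ((c⁻¹ : ℝ) : ℂ) * (cis (Real.pi + T.turn i) * T.finishDir i) := by
    have : cis (Real.pi + T.turn i) * cis (Real.pi - T.turn i) = 1 := by
      rw [← cis_add, ← cis_two_pi]
      congr 1
      ring
    rw [hw, Complex.ofReal_inv]
    field_simp
    linear_combination (-T.startDir i) * this
  have hu0 := T.startDir_ne_zero i
  have hw0 : T.finishDir i ≠ 0 := by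
    rw [hw]
    exact mul_ne_zero hc' (mul_ne_zero (cis_ne_zero _) hu0)
  have left : T.Sweeps (T.vertex i) (T.startDir i) (T.finishDir i) θ → θ = Real.pi - T.turn i →
      T.SidesAt T.inside T.outside i := by
    intro hsw hθ
    rw [← hθ] at hw
    refine sidesAt_of_rays hT T.saturated_inside T.saturated_outside i
      (fun η hη => hsw.ray_inside hc hw (hθ ▸ hη)) (fun η hη => hsw.ray_outside hc hw ?_)
    convert hη using 2
    rw [hθ]
    ring
  have right : T.Sweeps (T.vertex i) (T.finishDir i) (T.startDir i) θ → θ = Real.pi + T.turn i →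
      T.SidesAt T.outside T.inside i := by
    intro hsw hθ
    rw [← hθ] at hu
    refine sidesAt_of_rays hT T.saturated_outside T.saturated_inside i
      (fun η hη => (hsw.ray_outside (inv_pos.2 hc) hu ?_).symm)
      (fun η hη => (hsw.ray_inside (inv_pos.2 hc) hu (hθ ▸ hη)).symm)
    convert hη using 2
    rw [hθ]
    ring
  -- At a cusp both tangents have the same direction, and they may be exchanged.
  have swap : T.turn i = Real.pi ∨ T.turn i = -Real.pi →
      ∃ b : ℝ, 0 < b ∧ T.finishDir i = b * T.startDir i := by
    rintro (hs | hs)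
    · exact ⟨c, hc, by rw [hw, hs, sub_self, cis_zero, one_mul]⟩
    · refine ⟨c, hc, ?_⟩
      rw [hw, hs, show Real.pi - -Real.pi = 2 * Real.pi by ring, cis_two_pi, one_mul]
  have swap' : ∀ {b : ℝ}, 0 < b → T.finishDir i = b * T.startDir i →
      (T.Sweeps (T.vertex i) (T.startDir i) (T.finishDir i) θ ↔
        T.Sweeps (T.vertex i) (T.finishDir i) (T.startDir i) θ) := by
    intro b hb he
    have h1 := sweeps_smul_iff (T := T) (v := T.vertex i) (u := T.startDir i) (w := T.startDir i)
      (θ := θ) one_pos hb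
    have h2 := sweeps_smul_iff (T := T) (v := T.vertex i) (u := T.startDir i) (w := T.startDir i)
      (θ := θ) hb one_pos
    rw [Complex.ofReal_one, one_mul] at h1 h2
    rw [he, h1, h2]
  rcases h with h | h
  · obtain ⟨n, hn⟩ := exists_int_of_sameRay hu0 hc hw h.1
    by_cases hn0 : n = 0
    · rw [hn0, Int.cast_zero, zero_mul] at hn
      have : θ = Real.pi - T.turn i := by linarith
      exact Or.inl ⟨this, left h this⟩
    · have hcusp : θ = Real.pi + T.turn i ∧ (T.turn i = Real.pi ∨ T.turn i = -Real.pi) := by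
        rcases lt_or_gt_of_ne hn0 with hneg | hpos
        · have : (n : ℝ) ≤ -1 := by exact_mod_cast Int.le_sub_one_of_lt hneg
          have h1 : θ - (Real.pi - T.turn i) ≤ -(2 * Real.pi) := by rw [hn]; nlinarith
          exact ⟨by linarith, Or.inr (by linarith)⟩
        · have : (1 : ℝ) ≤ n := by exact_mod_cast hpos
          have h1 : 2 * Real.pi ≤ θ - (Real.pi - T.turn i) := by rw [hn]; nlinarith
          exact ⟨by linarith, Or.inl (by linarith)⟩
      obtain ⟨b, hb, hbe⟩ := swap hcusp.2
      exact Or.inr ⟨hcusp.1, right ((swap' hb hbe).1 h) hcusp.1⟩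
  · obtain ⟨n, hn⟩ := exists_int_of_sameRay hw0 (inv_pos.2 hc) hu h.1
    by_cases hn0 : n = 0
    · rw [hn0, Int.cast_zero, zero_mul] at hn
      have : θ = Real.pi + T.turn i := by linarith
      exact Or.inr ⟨this, right h this⟩
    · have hcusp : θ = Real.pi - T.turn i ∧ (T.turn i = Real.pi ∨ T.turn i = -Real.pi) := by
        rcases lt_or_gt_of_ne hn0 with hneg | hpos
        · have : (n : ℝ) ≤ -1 := by exact_mod_cast Int.le_sub_one_of_lt hneg
          have h1 : θ - (Real.pi + T.turn i) ≤ -(2 * Real.pi) := by rw [hn]; nlinarith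
          exact ⟨by linarith, Or.inl (by linarith)⟩
        · have : (1 : ℝ) ≤ n := by exact_mod_cast hpos
          have h1 : 2 * Real.pi ≤ θ - (Real.pi + T.turn i) := by rw [hn]; nlinarith
          exact ⟨by linarith, Or.inr (by linarith)⟩
      obtain ⟨b, hb, hbe⟩ := swap hcusp.2
      exact Or.inl ⟨hcusp.1, left ((swap' hb hbe).2 h) hcusp.1⟩

lemma eventually_dirIn_iff_left (hT : T.Simple) {i : Fin 3} (h1 : T.turn i < Real.pi)
    (h2 : T.turn (i + 1) < Real.pi) : ∀ᶠ η : ℝ in 𝓝[>] 0, ∀ S, Saturated T.boundary S →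
      (DirIn S (T.vertex i) (cis η * T.startDir i) ↔
        DirIn S (T.vertex (i + 1)) (cis (-η) * T.finishDir (i + 1))) := by
  obtain ⟨hs1, hs2⟩ := abs_le.1 (hT.abs_turn_le i)
  obtain ⟨ht1, ht2⟩ := abs_le.1 (hT.abs_turn_le (i + 1))
  obtain ⟨hg1, hg2⟩ : -Real.pi < T.deviation i ∧ T.deviation i < Real.pi :=
    abs_lt.1 (abs_arg_lt_pi (hT.oppForm_mem i))
  obtain ⟨hh1, hh2⟩ := abs_lt.1 (T.abs_half_lt i)
  have hpi := Real.pi_pos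
  filter_upwards [eventually_mem_Ioo_nhdsGT hpi, eventually_mem_Ioo_nhdsGT (sub_pos.2 h1),
    eventually_mem_Ioo_nhdsGT (sub_pos.2 h2), eventually_mem_Ioo_nhdsGT (sub_pos.2 hg2),
    eventually_mem_Ioo_nhdsGT (by linarith : 0 < T.half i + Real.pi)] with η a d e f g S hS
  have key := dirIn_startDir_iff_finishDir hT.oppForm_mem hS (i := i) (η := -η)
    (cis_ne_one (by linarith [a.1]) (abs_lt.2 ⟨by linarith [a.2], by linarith [a.1]⟩))
    (abs_lt.2 ⟨by linarith [g.2], by linarith [a.1]⟩)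
    (abs_lt.2 ⟨by linarith [a.1], by linarith [f.2]⟩)
    (abs_lt.2 ⟨by linarith [a.1], by linarith [d.2]⟩)
    (abs_lt.2 ⟨by linarith [a.1], by linarith [e.2]⟩)
  rwa [neg_neg] at key

lemma eventually_dirIn_iff_right (hT : T.Simple) {i : Fin 3} (h1 : -Real.pi < T.turn i)
    (h2 : -Real.pi < T.turn (i + 1)) : ∀ᶠ η : ℝ in 𝓝[>] 0, ∀ S, Saturated T.boundary S →
      (DirIn S (T.vertex i) (cis (-η) * T.startDir i) ↔
        DirIn S (T.vertex (i + 1)) (cis η * T.finishDir (i + 1))) := by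
  obtain ⟨hs1, hs2⟩ := abs_le.1 (hT.abs_turn_le i)
  obtain ⟨ht1, ht2⟩ := abs_le.1 (hT.abs_turn_le (i + 1))
  obtain ⟨hg1, hg2⟩ : -Real.pi < T.deviation i ∧ T.deviation i < Real.pi :=
    abs_lt.1 (abs_arg_lt_pi (hT.oppForm_mem i))
  obtain ⟨hh1, hh2⟩ := abs_lt.1 (T.abs_half_lt i)
  have hpi := Real.pi_pos
  filter_upwards [eventually_mem_Ioo_nhdsGT hpi,
    eventually_mem_Ioo_nhdsGT (by linarith : 0 < T.turn i + Real.pi),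
    eventually_mem_Ioo_nhdsGT (by linarith : 0 < T.turn (i + 1) + Real.pi),
    eventually_mem_Ioo_nhdsGT (by linarith : 0 < T.deviation i + Real.pi),
    eventually_mem_Ioo_nhdsGT (sub_pos.2 hh2)] with η a d e f g S hS
  exact dirIn_startDir_iff_finishDir hT.oppForm_mem hS
    (cis_ne_one (by linarith [a.1]) (abs_lt.2 ⟨by linarith [a.1], by linarith [a.2]⟩))
    (abs_lt.2 ⟨by linarith [a.1], by linarith [g.2]⟩)
    (abs_lt.2 ⟨by linarith [f.2], by linarith [a.1]⟩)
    (abs_lt.2 ⟨by linarith [d.2], by linarith [a.1]⟩)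
    (abs_lt.2 ⟨by linarith [e.2], by linarith [a.1]⟩)

/-- The interior lies on the same side of the boundary at the two ends of an edge. The edge is
followed on a side on which neither end has a cusp; there is one because cusps on different sides at
the two ends would give the edge deviations of both signs. -/
lemma exists_common_dirIn (hT : T.Simple) {S S' R R' : Set ℂ} (hS : Saturated T.boundary S)
    (hS' : Saturated T.boundary S') {i : Fin 3} (h1 : T.SidesAt S S' i)
    (h2 : T.SidesAt R R' (i + 1)) :
    (∃ V u, DirIn S V u ∧ DirIn R V u) ∨ ∃ V u, DirIn S' V u ∧ DirIn R' V u := by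
  obtain ⟨hs1, hs2⟩ := abs_le.1 (hT.abs_turn_le i)
  obtain ⟨ht1, ht2⟩ := abs_le.1 (hT.abs_turn_le (i + 1))
  have hg (j : Fin 3) := abs_lt.1 (abs_arg_lt_pi (hT.oppForm_mem j))
  obtain ⟨hg1, hg2⟩ : -Real.pi < T.deviation i ∧ T.deviation i < Real.pi := hg i
  have hcase : (T.turn i < Real.pi ∧ T.turn (i + 1) < Real.pi) ∨
      (-Real.pi < T.turn i ∧ -Real.pi < T.turn (i + 1)) := by
    by_contra hcon
    have e1 : T.turn i = T.deviation i + T.deviation (i + 2) := rfl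
    have e2 := T.turn_add_one i
    obtain ⟨h3, h4⟩ : -Real.pi < T.deviation (i + 1) ∧ T.deviation (i + 1) < Real.pi := hg (i + 1)
    obtain ⟨h5, h6⟩ : -Real.pi < T.deviation (i + 2) ∧ T.deviation (i + 2) < Real.pi := hg (i + 2)
    rw [not_or, not_and_or, not_and_or] at hcon
    rcases hcon with ⟨h | h, h' | h'⟩ <;> push Not at h h' <;> linarith
  rcases hcase with ⟨hl1, hl2⟩ | ⟨hr1, hr2⟩
  · obtain ⟨η, ⟨h, b⟩, c⟩ :=
      (((eventually_dirIn_iff_left hT hl1 hl2).and (h1.1 hl1)).and (h2.1 hl2)).exists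
    exact Or.inl ⟨_, _, (h S hS).1 b.1, c.2⟩
  · obtain ⟨η, ⟨h, b⟩, c⟩ :=
      (((eventually_dirIn_iff_right hT hr1 hr2).and (h1.2 hr1)).and (h2.2 hr2)).exists
    exact Or.inr ⟨_, _, (h S' hS').1 b.1, c.2⟩

lemma not_sidesAt_of_sidesAt (hT : T.Simple) {i : Fin 3}
    (h1 : T.SidesAt T.inside T.outside i) (h2 : T.SidesAt T.outside T.inside (i + 1)) : False := by
  rcases exists_common_dirIn hT T.saturated_inside T.saturated_outside h1 h2 with
    ⟨V, u, h, h'⟩ | ⟨V, u, h, h'⟩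
  · exact not_dirIn_inside_and_outside h h'
  · exact not_dirIn_inside_and_outside h' h

lemma not_sidesAt_of_sidesAt' (hT : T.Simple) {i : Fin 3}
    (h1 : T.SidesAt T.outside T.inside i) (h2 : T.SidesAt T.inside T.outside (i + 1)) : False := by
  rcases exists_common_dirIn hT T.saturated_outside T.saturated_inside h1 h2 with
    ⟨V, u, h, h'⟩ | ⟨V, u, h, h'⟩
  · exact not_dirIn_inside_and_outside h' h
  · exact not_dirIn_inside_and_outside h h'

/-- The angles of a simple arc-triangle determine the deviations of its edges from the circumcircle
up to a common sign. -/
theorem abs_circumcircleAngle_lt (hT : T.Simple) {θ : Fin 3 → ℝ}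
    (hθ : ∀ i, T.IsInteriorAngle i (θ i)) (i : Fin 3) :
    |circumcircleAngle θ i| < Real.pi := by
  have hg (j : Fin 3) : |T.deviation j| < Real.pi := abs_arg_lt_pi (hT.oppForm_mem j)
  have hall : (∀ j, θ j = Real.pi - T.turn j) ∨ (∀ j, θ j = Real.pi + T.turn j) := by
    have key (j : Fin 3) := (hθ j).eq_and_sidesAt hT
    rcases key 0 with ⟨h0, s0⟩ | ⟨h0, s0⟩
    · rcases key 1 with ⟨h1, s1⟩ | ⟨h1, s1⟩
      · rcases key 2 with ⟨h2, s2⟩ | ⟨h2, s2⟩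
        · exact Or.inl (Fin.forall_fin_succ.2 ⟨h0, Fin.forall_fin_two.2 ⟨h1, h2⟩⟩)
        · exact (not_sidesAt_of_sidesAt hT s1 s2).elim
      · exact (not_sidesAt_of_sidesAt hT s0 s1).elim
    · rcases key 1 with ⟨h1, s1⟩ | ⟨h1, s1⟩
      · exact (not_sidesAt_of_sidesAt' hT s0 s1).elim
      · rcases key 2 with ⟨h2, s2⟩ | ⟨h2, s2⟩
        · exact (not_sidesAt_of_sidesAt' hT s1 s2).elim
        · exact Or.inr (Fin.forall_fin_succ.2 ⟨h0, Fin.forall_fin_two.2 ⟨h1, h2⟩⟩)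
  have hsum := fin_three_sum_eq θ i
  have e1 : T.turn i = T.deviation i + T.deviation (i + 2) := rfl
  have e2 := T.turn_add_one i
  have e3 : T.turn (i + 2) = T.deviation (i + 2) + T.deviation (i + 1) := by
    rw [turn, fin_three_add_two_add_two]
  rcases hall with hall | hall
  · have : circumcircleAngle θ i = T.deviation (i + 1) := by
      rw [circumcircleAngle, hsum, hall, hall, hall, e1, e2, e3]
      ring
    rw [this]
    exact hg _
  · have : circumcircleAngle θ i = -T.deviation (i + 1) := by
      rw [circumcircleAngle, hsum, hall, hall, hall, e1, e2, e3]
      ring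
    rw [this, abs_neg]
    exact hg _

/-! ### The winding angle of the boundary -/

/-- The total angle through which the boundary turns around `z`: the sum over the edges of the
angles under which they are seen from `z`. -/
noncomputable def windingAngle (T : ArcTriangle) (z : ℂ) : ℝ :=
  ∑ i, (T.half i + (arcForm (T.vertex i) (T.vertex (i + 1)) (T.half i) z).arg)

lemma arcForm_mem_of_notMem_boundary {z : ℂ} (hz : z ∈ T.boundaryᶜ) (i : Fin 3) :
    arcForm (T.vertex i) (T.vertex (i + 1)) (T.half i) z ∈ Complex.slitPlane := by
  by_contra h
  refine hz (mem_iUnion.2 ⟨i, ?_⟩)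
  rw [carrier_edge]
  exact h

lemma continuousOn_windingAngle (T : ArcTriangle) : ContinuousOn T.windingAngle T.boundaryᶜ := by
  intro z hz
  refine ContinuousAt.continuousWithinAt ?_
  unfold windingAngle
  refine tendsto_finsetSum _ fun i _ => Tendsto.const_add _ ?_
  exact (Complex.continuousAt_arg (arcForm_mem_of_notMem_boundary hz i)).comp
    (continuous_arcForm _ _ _).continuousAt

lemma cis_windingAngle {z : ℂ} (hz : z ∈ T.boundaryᶜ) : cis (T.windingAngle z) = 1 := by
  have hF (i : Fin 3) := Complex.slitPlane_ne_zero (arcForm_mem_of_notMem_boundary hz i)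
  have key (i : Fin 3) : (‖arcForm (T.vertex i) (T.vertex (i + 1)) (T.half i) z‖ : ℂ) *
      cis (T.half i + (arcForm (T.vertex i) (T.vertex (i + 1)) (T.half i) z).arg) =
        (T.vertex (i + 1) - z) * conj (T.vertex i - z) := by
    rw [cis_add, mul_left_comm, cis_arg_mul_norm, arcForm]
    linear_combination ((T.vertex (i + 1) - z) * conj (T.vertex i - z)) *
      cis_mul_cis_neg (T.half i)
  set F : Fin 3 → ℂ := fun i => arcForm (T.vertex i) (T.vertex (i + 1)) (T.half i) z with hFdef
  have h1 : ((‖F 0‖ * ‖F 1‖ * ‖F 2‖ : ℝ) : ℂ) * cis (T.windingAngle z) =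
      ((Complex.normSq (T.vertex 0 - z) * Complex.normSq (T.vertex 1 - z) *
        Complex.normSq (T.vertex 2 - z) : ℝ) : ℂ) := by
    rw [windingAngle, Fin.sum_univ_three, cis_add, cis_add]
    have k0 := key 0
    have k1 := key 1
    have k2 := key 2
    simp only [show (0 : Fin 3) + 1 = 1 from rfl, show (1 : Fin 3) + 1 = 2 from rfl,
      show (2 : Fin 3) + 1 = 0 from rfl, hFdef] at k0 k1 k2 ⊢
    have e (i : Fin 3) := Complex.mul_conj (T.vertex i - z)
    push_cast
    rw [← e 0, ← e 1, ← e 2]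
    have k := congrArg₂ (· * ·) (congrArg₂ (· * ·) k0 k1) k2
    linear_combination k
  have hpos : 0 < ‖F 0‖ * ‖F 1‖ * ‖F 2‖ :=
    mul_pos (mul_pos (norm_pos_iff.2 (hF 0)) (norm_pos_iff.2 (hF 1))) (norm_pos_iff.2 (hF 2))
  have h2 := congrArg norm h1
  rw [norm_mul, norm_cis, mul_one, Complex.norm_real, Complex.norm_real,
    Real.norm_of_nonneg hpos.le, Real.norm_of_nonneg (mul_nonneg (mul_nonneg
      (Complex.normSq_nonneg _) (Complex.normSq_nonneg _)) (Complex.normSq_nonneg _))] at h2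
  rw [← h2] at h1
  exact mul_left_cancel₀ (Complex.ofReal_ne_zero.2 hpos.ne') (by rw [h1, mul_one])

lemma tendsto_arg_arcForm_cobounded (P Q : ℂ) {h : ℝ} (hh : |h| < Real.pi) :
    Tendsto (fun z => (arcForm P Q h z).arg) (Bornology.cobounded ℂ) (𝓝 (-h)) := by
  have h1 : Tendsto (fun z : ℂ => (P - z)⁻¹) (Bornology.cobounded ℂ) (𝓝 0) :=
    tendsto_inv₀_cobounded.comp (tendsto_const_sub_cobounded P)
  have h2 : Tendsto (fun z : ℂ => cis (-h) * (1 + (Q - P) * (P - z)⁻¹)) (Bornology.cobounded ℂ)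
      (𝓝 (cis (-h))) := by
    have := ((h1.const_mul (Q - P)).const_add 1).const_mul (cis (-h))
    simpa using this
  have hneg : |-h| < Real.pi := by rwa [abs_neg]
  have h3 := (Complex.continuousAt_arg (cis_mem_slitPlane hneg)).tendsto.comp h2
  rw [arg_cis ⟨(abs_lt.1 hneg).1, (abs_lt.1 hneg).2.le⟩] at h3
  refine h3.congr' ?_
  have hne : ∀ᶠ z in Bornology.cobounded ℂ, z ≠ P :=
    Bornology.isBounded_singleton (x := P)
  filter_upwards [hne] with z hz
  have hz0 : P - z ≠ 0 := sub_ne_zero.2 hz.symm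
  have e : arcForm P Q h z =
      (Complex.normSq (P - z) : ℝ) * (cis (-h) * (1 + (Q - P) * (P - z)⁻¹)) := by
    rw [← Complex.mul_conj, arcForm]
    field_simp
    ring
  rw [e, Complex.arg_real_mul _ (Complex.normSq_pos.2 hz0), Function.comp]

lemma tendsto_windingAngle_cobounded (T : ArcTriangle) :
    Tendsto T.windingAngle (Bornology.cobounded ℂ) (𝓝 0) := by
  have h1 : Tendsto T.windingAngle (Bornology.cobounded ℂ)
      (𝓝 (∑ i, (T.half i + -T.half i))) :=
    tendsto_finsetSum _ fun i _ =>
      (tendsto_arg_arcForm_cobounded _ _ (T.abs_half_lt i)).const_add _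
  simpa using h1

/-- The winding angle is a multiple of `2π`, hence constant on components, and it vanishes far
away. -/
lemma mem_inside_of_windingAngle_ne_zero {z : ℂ} (hz : z ∈ T.boundaryᶜ)
    (hW : T.windingAngle z ≠ 0) : z ∈ T.inside := by
  refine ⟨hz, ?_⟩
  by_contra hunb
  have h1 : ∀ᶠ y in Bornology.cobounded ℂ, |T.windingAngle y| < 1 := by
    have := T.tendsto_windingAngle_cobounded.abs
    rw [abs_zero] at this
    exact this.eventually_lt_const one_pos
  obtain ⟨y, hyC, hy⟩ : ∃ y ∈ connectedComponentIn T.boundaryᶜ z, |T.windingAngle y| < 1 := by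
    by_contra hcon
    push Not at hcon
    refine hunb (Bornology.isBounded_def.2 (mem_of_superset h1 fun y hy hyC => ?_))
    exact absurd hy (not_lt.2 (hcon y hyC))
  have hsub := connectedComponentIn_subset T.boundaryᶜ z
  have hcont : ContinuousOn (fun x => |T.windingAngle x|) (connectedComponentIn T.boundaryᶜ z) :=
    (T.continuousOn_windingAngle.mono hsub).abs
  have hge : 1 ≤ |T.windingAngle z| := by
    by_contra hlt
    exact cis_ne_one hW (by linarith [Real.pi_gt_three]) (cis_windingAngle hz)
  obtain ⟨x, hx, hx1⟩ := isPreconnected_connectedComponentIn.intermediate_value hyC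
    (mem_connectedComponentIn hz) hcont ⟨hy.le, hge⟩
  have hx1 : |T.windingAngle x| = 1 := hx1
  refine cis_ne_one (fun h0 => ?_) ?_ (cis_windingAngle (hsub hx))
  · rw [h0, abs_zero] at hx1
    exact zero_ne_one hx1
  · rw [hx1]
    linarith [Real.pi_gt_three]

lemma tendsto_arg_of_ofReal_mul {F : ℝ → ℂ} (hF : Continuous F) {c s : ℝ} (hc : 0 < c)
    (hs : |s| < Real.pi) (h0 : F 0 = c * cis s) :
    Tendsto (fun r : ℝ => ((r : ℂ) * F r).arg) (𝓝[>] 0) (𝓝 s) := by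
  have hmem : F 0 ∈ Complex.slitPlane := by
    rw [h0, ofReal_mul_mem_slitPlane hc]
    exact cis_mem_slitPlane hs
  have harg : (F 0).arg = s := by
    rw [h0, Complex.arg_real_mul _ hc, arg_cis ⟨(abs_lt.1 hs).1, (abs_lt.1 hs).2.le⟩]
  have h1 : Tendsto (fun r => (F r).arg) (𝓝[>] 0) (𝓝 s) := by
    have := (Complex.continuousAt_arg hmem).tendsto.comp hF.continuousAt.tendsto
    rw [harg] at this
    exact this.mono_left nhdsWithin_le_nhds
  refine h1.congr' ?_
  filter_upwards [self_mem_nhdsWithin] with r hr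
  rw [Complex.arg_real_mul _ hr]

/-- The winding angle on the left of the boundary at a vertex. -/
lemma tendsto_windingAngle (hopp : ∀ i, T.oppForm i ∈ Complex.slitPlane) (i : Fin 3)
    (hturn : -Real.pi ≤ T.turn i) {t : ℝ} (ht : t ∈ Ioo 0 (Real.pi - T.turn i)) :
    Tendsto (fun r : ℝ => T.windingAngle (T.vertex i + r * (cis t * T.startDir i))) (𝓝[>] 0)
      (𝓝 (Real.pi + ∑ j, (T.half j + T.deviation j))) := by
  have hn0 := Complex.normSq_pos.2 (T.startDir_ne_zero i)
  obtain ⟨c, hc, he⟩ := exists_neg_mul_conj_finishDir hopp i t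
  have hstart : Tendsto (fun r : ℝ => (arcForm (T.vertex i) (T.vertex (i + 1)) (T.half i)
      (T.vertex i + r * (cis t * T.startDir i))).arg) (𝓝[>] 0) (𝓝 (Real.pi - t)) := by
    simp_rw [arcForm_left_add]
    refine tendsto_arg_of_ofReal_mul (by fun_prop) hn0
      (abs_lt.2 ⟨by linarith [ht.2], by linarith [ht.1]⟩) ?_
    rw [← neg_startDir_mul_conj, Complex.ofReal_zero, zero_mul, sub_zero,
      mul_comm (cis (-T.half i))]
  have hfinish : Tendsto (fun r : ℝ => (arcForm (T.vertex (i + 2)) (T.vertex i) (T.half (i + 2))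
      (T.vertex i + r * (cis t * T.startDir i))).arg) (𝓝[>] 0) (𝓝 (t + T.turn i)) := by
    simp_rw [arcForm_right_add]
    refine tendsto_arg_of_ofReal_mul ?_ hc
      (abs_lt.2 ⟨by linarith [ht.1], by linarith [ht.2]⟩) ?_
    · have : Continuous fun r : ℝ =>
          conj (T.vertex (i + 2) - T.vertex i - r * (cis t * T.startDir i)) :=
        Complex.continuous_conj.comp (by fun_prop)
      fun_prop
    · rw [← he, Complex.ofReal_zero, zero_mul, sub_zero, map_mul, conj_cis]
      ring
  have hopposite : Tendsto (fun r : ℝ => (arcForm (T.vertex (i + 1)) (T.vertex (i + 2))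
      (T.half (i + 1)) (T.vertex i + r * (cis t * T.startDir i))).arg) (𝓝[>] 0)
      (𝓝 (T.deviation (i + 1))) := by
    have h1 : Continuous fun r : ℝ => arcForm (T.vertex (i + 1)) (T.vertex (i + 2))
      (T.half (i + 1)) (T.vertex i + r * (cis t * T.startDir i)) :=
      (continuous_arcForm _ _ _).comp (by fun_prop)
    have h2 := hopp (i + 1)
    rw [oppForm_add_one] at h2
    have h3 : ContinuousAt (fun r : ℝ => (arcForm (T.vertex (i + 1)) (T.vertex (i + 2))
        (T.half (i + 1)) (T.vertex i + r * (cis t * T.startDir i))).arg) 0 := by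
      refine ContinuousAt.comp (g := Complex.arg) (Complex.continuousAt_arg ?_) h1.continuousAt
      simpa using h2
    have h4 := h3.tendsto
    rw [Complex.ofReal_zero, zero_mul, add_zero, ← oppForm_add_one] at h4
    exact h4.mono_left nhdsWithin_le_nhds
  have hW (z : ℂ) : T.windingAngle z =
      (T.half i + (arcForm (T.vertex i) (T.vertex (i + 1)) (T.half i) z).arg) +
      (T.half (i + 1) +
        (arcForm (T.vertex (i + 1)) (T.vertex (i + 2)) (T.half (i + 1)) z).arg) +
      (T.half (i + 2) + (arcForm (T.vertex (i + 2)) (T.vertex i) (T.half (i + 2)) z).arg) := by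
    rw [windingAngle, fin_three_sum_eq _ i, fin_three_add_one_add_one, fin_three_add_two_add_one]
  simp_rw [hW]
  convert ((hstart.const_add (T.half i)).add (hopposite.const_add (T.half (i + 1)))).add
    (hfinish.const_add (T.half (i + 2))) using 2
  rw [fin_three_sum_eq _ i, turn]
  ring

/-! ### Sectors outside -/

/-- A half line that avoids the boundary lies outside. -/
lemma mem_outside_of_ray {v u : ℂ} (hu : u ≠ 0)
    (h : ∀ r : ℝ, 0 < r → v + r * u ∉ T.boundary) {r : ℝ} (hr : 0 < r) :
    v + r * u ∈ T.outside := by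
  refine ⟨h r hr, fun hb => ?_⟩
  set K : Set ℂ := (fun s : ℝ => v + s * u) '' Ioi 0 with hK
  have hKc : IsPreconnected K := isPreconnected_Ioi.image _ (by fun_prop)
  have hKb : Bornology.IsBounded K := hb.subset
    (hKc.subset_connectedComponentIn ⟨r, hr, rfl⟩ (by rintro _ ⟨s, hs, rfl⟩; exact h s hs))
  obtain ⟨C, hC⟩ := hKb.exists_norm_le
  have hu0 : 0 < ‖u‖ := norm_pos_iff.2 hu
  have hs0 : 0 < (|C| + ‖v‖ + 1) / ‖u‖ := by positivity
  have h1 := hC _ ⟨_, hs0, rfl⟩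
  have h2 : ‖(((|C| + ‖v‖ + 1) / ‖u‖ : ℝ) : ℂ) * u‖ = |C| + ‖v‖ + 1 := by
    rw [norm_mul, Complex.norm_real, Real.norm_of_nonneg hs0.le]
    field_simp
  have h3 := norm_sub_norm_le ((((|C| + ‖v‖ + 1) / ‖u‖ : ℝ) : ℂ) * u) (-v)
  rw [norm_neg, sub_neg_eq_add, add_comm _ v, h2] at h3
  have h1' : ‖v + (((|C| + ‖v‖ + 1) / ‖u‖ : ℝ) : ℂ) * u‖ ≤ C := h1
  linarith [le_abs_self C]

/-- All directions on the right of the boundary at `vertex i` lead outside. -/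
def RightOutside (T : ArcTriangle) (i : Fin 3) : Prop :=
  ∀ t ∈ Ioo (Real.pi - T.turn i) (2 * Real.pi),
    DirIn T.outside (T.vertex i) (cis t * T.startDir i)

lemma dirIn_compl_boundary_right (hT : T.Simple) (i : Fin 3) {t : ℝ}
    (ht : t ∈ Ioo (Real.pi - T.turn i) (2 * Real.pi)) :
    DirIn T.boundaryᶜ (T.vertex i) (cis t * T.startDir i) := by
  obtain ⟨h1, h2⟩ := abs_le.1 (hT.abs_turn_le i)
  have hpi := Real.pi_pos
  refine dirIn_compl_boundary_startDir hT.oppForm_mem i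
    (cis_ne_one (by linarith [ht.1]) (abs_lt.2 ⟨by linarith [ht.1], ht.2⟩)) fun h => ?_
  refine cis_ne_one (t := t + T.turn i - Real.pi) (by linarith [ht.1])
    (abs_lt.2 ⟨by linarith [ht.1], by linarith [ht.2]⟩) ?_
  rw [← neg_cis, h, neg_neg]

lemma rightOutside_of_dirIn (hT : T.Simple) {i : Fin 3} {t : ℝ}
    (ht : t ∈ Ioo (Real.pi - T.turn i) (2 * Real.pi))
    (h : DirIn T.outside (T.vertex i) (cis t * T.startDir i)) : T.RightOutside i := by
  intro s hs
  have hD : IsPreconnected ((fun t : ℝ => cis t * T.startDir i) ''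
      Ioo (Real.pi - T.turn i) (2 * Real.pi)) :=
    isPreconnected_Ioo.image _ (continuous_cis.mul continuous_const).continuousOn
  refine T.saturated_outside.dirIn_of_isPreconnected hD ?_ ⟨t, ht, rfl⟩ h ⟨s, hs, rfl⟩
  rintro _ ⟨r, hr, rfl⟩
  exact dirIn_compl_boundary_right hT i hr

lemma cis_two_pi_sub (t : ℝ) : cis (2 * Real.pi - t) = cis (-t) := by
  rw [sub_eq_add_neg, cis_add, cis_two_pi, one_mul]

lemma dirIn_finishDir_iff (hopp : ∀ i, T.oppForm i ∈ Complex.slitPlane) {S : Set ℂ} (i : Fin 3)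
    (η : ℝ) : DirIn S (T.vertex i) (cis η * T.finishDir i) ↔
      DirIn S (T.vertex i) (cis (Real.pi - T.turn i + η) * T.startDir i) := by
  obtain ⟨c, hc, hw⟩ := exists_finishDir_eq hopp i
  have hc' : (c : ℂ) ≠ 0 := by exact_mod_cast hc.ne'
  have e : cis η * T.finishDir i = c * (cis (Real.pi - T.turn i + η) * T.startDir i) := by
    rw [hw, cis_add]
    ring
  constructor
  · intro h
    have := h.smul (inv_pos.2 hc)
    rwa [e, Complex.ofReal_inv, inv_mul_cancel_left₀ hc'] at this
  · intro h
    rw [e]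
    exact h.smul hc

/-- Unless one of the two vertices has a cusp on the right, the directions on the right of the
boundary lead outside at both ends of an edge as soon as they do at one end. -/
lemma rightOutside_add_one_iff (hT : T.Simple) {i : Fin 3} (h1 : -Real.pi < T.turn i)
    (h2 : -Real.pi < T.turn (i + 1)) : T.RightOutside i ↔ T.RightOutside (i + 1) := by
  obtain ⟨η, ⟨h, hη⟩, hη'⟩ := (((eventually_dirIn_iff_right hT h1 h2).and
    (eventually_mem_Ioo_nhdsGT (by linarith : 0 < Real.pi + T.turn i))).and
    (eventually_mem_Ioo_nhdsGT (by linarith : 0 < Real.pi + T.turn (i + 1)))).exists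
  have h := h _ T.saturated_outside
  rw [dirIn_finishDir_iff hT.oppForm_mem, ← cis_two_pi_sub] at h
  have m1 : 2 * Real.pi - η ∈ Ioo (Real.pi - T.turn i) (2 * Real.pi) :=
    ⟨by linarith [hη.2], by linarith [hη.1]⟩
  have m2 : Real.pi - T.turn (i + 1) + η ∈ Ioo (Real.pi - T.turn (i + 1)) (2 * Real.pi) :=
    ⟨by linarith [hη'.1], by linarith [hη'.2]⟩
  exact ⟨fun H => rightOutside_of_dirIn hT m2 (h.1 (H _ m1)),
    fun H => rightOutside_of_dirIn hT m1 (h.2 (H _ m2))⟩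

/-- A simple arc-triangle whose interior lies on the left of the boundary has the interior angles
`π - turn i`. -/
lemma isInteriorAngle_of_rightOutside (hT : T.Simple)
    (hsum : Real.pi + ∑ j, (T.half j + T.deviation j) ≠ 0) {i : Fin 3} (h : T.RightOutside i) :
    T.IsInteriorAngle i (Real.pi - T.turn i) := by
  obtain ⟨h1, h2⟩ := abs_le.1 (hT.abs_turn_le i)
  obtain ⟨c, hc, hw⟩ := exists_finishDir_eq hT.oppForm_mem i
  refine (T.isInteriorAngle_iff i _).2
    ⟨⟨by linarith, by linarith⟩, Or.inl ⟨?_, fun t ht => ?_, fun t ht => (h t ht).ray⟩⟩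
  · rw [hw, ← Complex.real_smul]
    exact SameRay.sameRay_pos_smul_right _ hc
  · have hfree : DirIn T.boundaryᶜ (T.vertex i) (cis t * T.startDir i) := by
      refine dirIn_compl_boundary_startDir hT.oppForm_mem i (cis_ne_one ht.1.ne' ?_)
        (cis_ne_neg_one ?_)
      · exact abs_lt.2 ⟨by linarith [ht.1, Real.pi_pos], by linarith [ht.2]⟩
      · exact abs_lt.2 ⟨by linarith [ht.1], by linarith [ht.2]⟩
    have hW := (tendsto_windingAngle hT.oppForm_mem i h1 ht).eventually_ne hsum
    filter_upwards [hW, hfree.ray] with r hr hr'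
    exact mem_inside_of_windingAngle_ne_zero hr' hr

end ArcTriangle

/-! ### Construction of an arc-triangle with given deviations -/

/-- A choice of the angles `x`, `y`, `z` of a straight triangle for given deviations `a`, `b`, `c`
of the edges opposite to them. The upper bounds keep the edges from passing through infinity, and
`0 < x + c` makes infinity visible from one of the vertices. -/
lemma exists_triangle_angles {a b c : ℝ} (ha : |a| < Real.pi) (hb : |b| < Real.pi)
    (hc : |c| < Real.pi) (hbc : |b + c| ≤ Real.pi) :
    ∃ x y z : ℝ, 0 < x ∧ 0 < y ∧ 0 < z ∧ x + y + z = Real.pi ∧ x < Real.pi + a ∧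
      y < Real.pi + b ∧ z < Real.pi + c ∧ (-Real.pi < a + c → 0 < x + c) := by
  obtain ⟨ha1, ha2⟩ := abs_lt.1 ha
  obtain ⟨hb1, hb2⟩ := abs_lt.1 hb
  obtain ⟨hc1, hc2⟩ := abs_lt.1 hc
  obtain ⟨hbc1, -⟩ := abs_le.1 hbc
  have hpi := Real.pi_pos
  obtain ⟨x, hx0, hx1, hx2, hx3⟩ : ∃ x, 0 < x ∧ x < Real.pi ∧ x < Real.pi + a ∧
      (-Real.pi < a + c → 0 < x + c) := by
    by_cases hac : -Real.pi < a + c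
    · obtain ⟨x, h1, h2⟩ := exists_between (show max 0 (-c) < min Real.pi (Real.pi + a) from
        max_lt (lt_min hpi (by linarith)) (lt_min (by linarith) (by linarith)))
      obtain ⟨h3, h4⟩ := max_lt_iff.1 h1
      obtain ⟨h5, h6⟩ := lt_min_iff.1 h2
      exact ⟨x, h3, h5, h6, fun _ => by linarith⟩
    · obtain ⟨x, h1, h2⟩ := exists_between (show 0 < min Real.pi (Real.pi + a) from
        lt_min hpi (by linarith))
      obtain ⟨h5, h6⟩ := lt_min_iff.1 h2
      exact ⟨x, h1, h5, h6, fun h => absurd h hac⟩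
  have hd : 0 < 2 * Real.pi + b + c := by linarith
  have hq : (Real.pi - x) / (2 * Real.pi + b + c) < 1 := by
    rw [div_lt_one hd]
    linarith
  have hq0 : 0 < (Real.pi - x) / (2 * Real.pi + b + c) := div_pos (by linarith) hd
  have hb3 : 0 < Real.pi + b := by linarith
  have hc3 : 0 < Real.pi + c := by linarith
  refine ⟨x, (Real.pi - x) / (2 * Real.pi + b + c) * (Real.pi + b),
    (Real.pi - x) / (2 * Real.pi + b + c) * (Real.pi + c), hx0, mul_pos hq0 hb3, mul_pos hq0 hc3,
    ?_, hx2, mul_lt_of_lt_one_left hb3 hq, mul_lt_of_lt_one_left hc3 hq, hx3⟩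
  linear_combination div_mul_cancel₀ (Real.pi - x) hd.ne'

lemma exists_vertices {α : Fin 3 → ℝ} (h0 : ∀ i, 0 < α i) (hsum : α 0 + α 1 + α 2 = Real.pi) :
    ∃ v : Fin 3 → ℂ, ∀ i, v i ≠ v (i + 1) ∧
      ∃ c : ℝ, 0 < c ∧ v (i + 2) - v i = c * (cis (α i) * (v (i + 1) - v i)) := by
  have hs (i : Fin 3) : 0 < Real.sin (α i) := by
    refine Real.sin_pos_of_pos_of_lt_pi (h0 i) ?_
    have := h0 0
    have := h0 1
    have := h0 2
    fin_cases i <;> simp only [Fin.mk_one, Fin.zero_eta, Fin.reduceFinMk] <;> linarith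
  have hsne (i : Fin 3) : (Real.sin (α i) : ℂ) ≠ 0 := by exact_mod_cast (hs i).ne'
  -- The law of sines gives the sides; the third side is computed from the sum of the angles.
  have h12 : (Real.sin (α 1) : ℂ) * cis (α 0) - Real.sin (α 2) =
      -(Real.sin (α 0) * cis (-α 1)) := by
    have h2 : Real.sin (α 2) =
        Real.sin (α 0) * Real.cos (α 1) + Real.cos (α 0) * Real.sin (α 1) := by
      rw [← Real.sin_add, ← Real.sin_pi_sub]
      congr 1
      linarith
    rw [h2]
    apply Complex.ext
    · simp only [Complex.sub_re, Complex.neg_re, Complex.re_ofReal_mul, cis_re, Real.cos_neg,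
        Complex.ofReal_re]
      ring
    · simp only [Complex.sub_im, Complex.neg_im, Complex.im_ofReal_mul, cis_im, Real.sin_neg,
        Complex.ofReal_im]
      ring
  have h3 : cis (α 2) * cis (α 0) = -cis (-α 1) := by
    rw [← cis_add, show α 2 + α 0 = Real.pi + -α 1 by linarith, cis_add, cis_pi, neg_one_mul]
  have h4 : cis (α 1) * cis (-α 1) = 1 := cis_mul_cis_neg _
  refine ⟨![0, (Real.sin (α 2) : ℂ), Real.sin (α 1) * cis (α 0)], fun i => ?_⟩
  fin_cases i
  · refine ⟨(hsne 2).symm, Real.sin (α 1) / Real.sin (α 2), div_pos (hs 1) (hs 2), ?_⟩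
    change (Real.sin (α 1) : ℂ) * cis (α 0) - 0 =
      ((Real.sin (α 1) / Real.sin (α 2) : ℝ) : ℂ) * (cis (α 0) * (Real.sin (α 2) - 0))
    have := hsne 2
    rw [Complex.ofReal_div]
    field_simp
    ring
  · constructor
    · change (Real.sin (α 2) : ℂ) ≠ Real.sin (α 1) * cis (α 0)
      rw [ne_comm, ← sub_ne_zero, h12]
      exact neg_ne_zero.2 (mul_ne_zero (hsne 0) (cis_ne_zero _))
    · refine ⟨Real.sin (α 2) / Real.sin (α 0), div_pos (hs 2) (hs 0), ?_⟩
      change (0 : ℂ) - Real.sin (α 2) = ((Real.sin (α 2) / Real.sin (α 0) : ℝ) : ℂ) *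
        (cis (α 1) * (Real.sin (α 1) * cis (α 0) - Real.sin (α 2)))
      have := hsne 0
      rw [h12, Complex.ofReal_div]
      field_simp
      linear_combination (Real.sin (α 2) : ℂ) * h4
  · constructor
    · change (Real.sin (α 1) : ℂ) * cis (α 0) ≠ 0
      exact mul_ne_zero (hsne 1) (cis_ne_zero _)
    · refine ⟨Real.sin (α 0) / Real.sin (α 1), div_pos (hs 0) (hs 1), ?_⟩
      change (Real.sin (α 2) : ℂ) - Real.sin (α 1) * cis (α 0) =
        ((Real.sin (α 0) / Real.sin (α 1) : ℝ) : ℂ) *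
          (cis (α 2) * (0 - Real.sin (α 1) * cis (α 0)))
      have := hsne 1
      rw [Complex.ofReal_div]
      field_simp
      linear_combination (Real.sin (α 1) : ℂ) * (-h12 + (Real.sin (α 0) : ℂ) * h3)

lemma mul_cis_add_mul_cis_mem_slitPlane {r c x y : ℝ} (hr : 0 < r) (hc : 0 < c)
    (hx : |x| < Real.pi) (hy : |y| < Real.pi) (hxy : |y - x| < Real.pi) :
    (r : ℂ) * cis x + c * cis y ∈ Complex.slitPlane := by
  by_contra h
  obtain ⟨s, hs, h⟩ := notMem_slitPlane_iff.1 h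
  rcases hs.eq_or_lt with rfl | hs
  · have h1 : cis (y - x) ∈ Complex.slitPlane := cis_mem_slitPlane hxy
    rw [← ofReal_mul_mem_slitPlane hc] at h1
    refine notMem_slitPlane_iff.2 ⟨r, hr.le, ?_⟩ h1
    rw [sub_eq_add_neg, cis_add]
    rw [Complex.ofReal_zero, neg_zero] at h
    linear_combination (cis (-x)) * h - r * cis_mul_cis_neg x
  · have hs' : (s : ℂ) ≠ 0 := by exact_mod_cast hs.ne'
    have h1 := (exists_one_add_cis_eq_zero_iff (a := -x) (by rwa [abs_neg]) hy).1
      ⟨r / s, c / s, by positivity, by positivity, by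
        rw [neg_neg, Complex.ofReal_div, Complex.ofReal_div]
        field_simp
        linear_combination h⟩
    rw [neg_add_eq_sub] at h1
    linarith

namespace ArcTriangle

variable {T : ArcTriangle}

/-- The half line that prolongs the chord from `vertex (i + 1)` to `vertex i` beyond `vertex i`
avoids the boundary. Here `α` is the straight angle at `vertex i`; from the points of the half line
the chords of the other two edges are seen under angles of absolute value at most `α`. -/
lemma prolonged_chord_notMem_boundary {i : Fin 3} {α c : ℝ} (hc : 0 < c)
    (hv : T.vertex (i + 2) - T.vertex i = c * (cis α * (T.vertex (i + 1) - T.vertex i)))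
    (hα0 : 0 < α) (hα1 : α < Real.pi) (h1 : α - T.half (i + 1) < Real.pi)
    (h2 : T.half (i + 2) + α < Real.pi) {r : ℝ} (hr : 0 < r) :
    T.vertex i + r * -(T.vertex (i + 1) - T.vertex i) ∉ T.boundary := by
  have hd := sub_ne_zero.2 (T.vertex_ne i).symm
  have e1 : T.vertex (i + 1) = T.vertex i + (T.vertex (i + 1) - T.vertex i) := by ring
  have e2 : T.vertex (i + 2) = T.vertex i + c * (cis α * (T.vertex (i + 1) - T.vertex i)) := by
    rw [← hv]; ring
  generalize T.vertex (i + 1) - T.vertex i = d at *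
  have hn0 : (0 : ℝ) < Complex.normSq d := Complex.normSq_pos.2 hd
  have hn : d * conj d = (Complex.normSq d : ℂ) := Complex.mul_conj _
  obtain ⟨ha1, ha2⟩ := abs_lt.1 (T.abs_half_lt (i + 1))
  obtain ⟨hb1, hb2⟩ := abs_lt.1 (T.abs_half_lt (i + 2))
  rw [T.boundary_eq i, mem_union, mem_union, not_or, not_or]
  simp only [arcSet, mem_ofPred_eq, not_not]
  refine ⟨?_, ?_, ?_⟩
  · have e : arcForm (T.vertex i) (T.vertex (i + 1)) (T.half i) (T.vertex i + r * -d) =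
        ((r * (1 + r) * Complex.normSq d : ℝ) : ℂ) * cis (-T.half i) := by
      rw [arcForm, e1]
      push_cast
      rw [← hn, show T.vertex i - (T.vertex i + r * -d) = r * d by ring, map_mul,
        Complex.conj_ofReal]
      ring
    rw [e, ofReal_mul_mem_slitPlane (by positivity)]
    exact cis_mem_slitPlane (by rw [abs_neg]; exact T.abs_half_lt i)
  · have e : arcForm (T.vertex (i + 1)) (T.vertex (i + 2)) (T.half (i + 1))
        (T.vertex i + r * -d) = (((1 + r) * Complex.normSq d : ℝ) : ℂ) *
          (r * cis (-T.half (i + 1)) + c * cis (α - T.half (i + 1))) := by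
      rw [arcForm, e1, e2, sub_eq_add_neg α, cis_add]
      push_cast
      rw [← hn, show T.vertex i + d - (T.vertex i + r * -d) = ((1 + r : ℝ) : ℂ) * d by
        push_cast; ring, map_mul, Complex.conj_ofReal]
      push_cast
      ring
    rw [e, ofReal_mul_mem_slitPlane (by positivity)]
    refine mul_cis_add_mul_cis_mem_slitPlane hr hc (by rw [abs_neg]; exact T.abs_half_lt _)
      (abs_lt.2 ⟨by linarith, h1⟩) ?_
    rw [sub_neg_eq_add, sub_add_cancel]
    exact abs_lt.2 ⟨by linarith, hα1⟩
  · have e : arcForm (T.vertex (i + 2)) (T.vertex i) (T.half (i + 2))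
        (T.vertex i + r * -d) = ((r * Complex.normSq d : ℝ) : ℂ) *
          (r * cis (-T.half (i + 2)) + c * cis (-T.half (i + 2) - α)) := by
      rw [arcForm, e2, sub_eq_add_neg _ α, cis_add]
      push_cast
      rw [← hn, show T.vertex i + c * (cis α * d) - (T.vertex i + r * -d) = c * (cis α * d) + r * d
        by ring, map_add, map_mul, map_mul, map_mul, conj_cis, Complex.conj_ofReal,
        Complex.conj_ofReal]
      ring
    rw [e, ofReal_mul_mem_slitPlane (by positivity)]
    refine mul_cis_add_mul_cis_mem_slitPlane hr hc (by rw [abs_neg]; exact T.abs_half_lt _)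
      (abs_lt.2 ⟨by linarith, by linarith⟩) ?_
    rw [sub_sub_cancel_left, abs_neg]
    exact abs_lt.2 ⟨by linarith, hα1⟩

/-- An arc-triangle with prescribed straight angles `α i` and prescribed deviations `g i`. -/
lemma exists_arcTriangle {α g : Fin 3 → ℝ} (h0 : ∀ i, 0 < α i)
    (hsum : α 0 + α 1 + α 2 = Real.pi) (hg : ∀ i, |g i| < Real.pi)
    (hα : ∀ i, α (i + 2) < Real.pi + g i) :
    ∃ T : ArcTriangle, (∀ i, T.oppForm i ∈ Complex.slitPlane) ∧ (∀ i, T.deviation i = g i) ∧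
      (∀ i, T.half i = α (i + 2) - g i) ∧ ∀ i, ∃ c : ℝ, 0 < c ∧
        T.vertex (i + 2) - T.vertex i =
          c * (cis (α i) * (T.vertex (i + 1) - T.vertex i)) := by
  obtain ⟨v, hv⟩ := exists_vertices h0 hsum
  have hh (i : Fin 3) : |α (i + 2) - g i| < Real.pi :=
    abs_lt.2 ⟨by linarith [h0 (i + 2), (abs_lt.1 (hg i)).2], by linarith [hα i]⟩
  choose e he1 he2 he3 using fun i => CircularArc.exists_eq (hv i).1 (hh i)
  let T : ArcTriangle := ⟨v, e, he1, he2⟩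
  have hhalf (i : Fin 3) : T.half i = α (i + 2) - g i := he3 i
  have hform (i : Fin 3) : ∃ c : ℝ, 0 < c ∧ T.oppForm i = c * cis (g i) := by
    obtain ⟨hne, -⟩ := hv (i + 2)
    obtain ⟨c, hc, hcv⟩ := (hv (i + 2)).2
    rw [fin_three_add_two_add_one] at hne
    rw [fin_three_add_two_add_one, fin_three_add_two_add_two] at hcv
    refine ⟨c * Complex.normSq (v i - v (i + 2)), mul_pos hc
      (Complex.normSq_pos.2 (sub_ne_zero.2 hne.symm)), ?_⟩
    rw [oppForm, arcForm, hhalf]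
    change cis (-(α (i + 2) - g i)) * (v (i + 1) - v (i + 2)) * conj (v i - v (i + 2)) = _
    rw [hcv, neg_sub, sub_eq_add_neg, cis_add, Complex.ofReal_mul, ← Complex.mul_conj]
    linear_combination (c * cis (g i) * (v i - v (i + 2)) * conj (v i - v (i + 2))) *
      cis_neg_mul_cis (α (i + 2))
  refine ⟨T, fun i => ?_, fun i => ?_, hhalf, fun i => (hv i).2⟩
  · obtain ⟨c, hc, h⟩ := hform i
    rw [h, ofReal_mul_mem_slitPlane hc]
    exact cis_mem_slitPlane (hg i)
  · obtain ⟨c, hc, h⟩ := hform i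
    rw [deviation, h, Complex.arg_real_mul _ hc,
      arg_cis ⟨(abs_lt.1 (hg i)).1, (abs_lt.1 (hg i)).2.le⟩]

lemma exists_angles_at {g : Fin 3 → ℝ} (hg : ∀ i, |g i| < Real.pi)
    (hs : ∀ i, |g i + g (i + 2)| ≤ Real.pi) (i₀ : Fin 3) :
    ∃ α : Fin 3 → ℝ, (∀ i, 0 < α i) ∧ α 0 + α 1 + α 2 = Real.pi ∧
      (∀ i, α (i + 2) < Real.pi + g i) ∧
      (-Real.pi < g i₀ + g (i₀ + 2) → 0 < α (i₀ + 2) + g (i₀ + 2)) := by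
  have hbc := hs (i₀ + 2)
  rw [fin_three_add_two_add_two, add_comm] at hbc
  obtain ⟨x, y, z, hx, hy, hz, hxyz, h1, h2, h3, h4⟩ :=
    exists_triangle_angles (hg i₀) (hg (i₀ + 1)) (hg (i₀ + 2)) hbc
  have key : ∀ i : Fin 3, i = i₀ ∨ i = i₀ + 1 ∨ i = i₀ + 2 := by
    intro i
    clear * -
    revert i i₀
    decide
  have n1 : i₀ + 1 ≠ i₀ := by clear * -; revert i₀; decide
  have n2 : i₀ + 2 ≠ i₀ := by clear * -; revert i₀; decide
  have n3 : i₀ + 2 ≠ i₀ + 1 := by clear * -; revert i₀; decide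
  let α : Fin 3 → ℝ := fun i => if i = i₀ then y else if i = i₀ + 1 then z else x
  have a0 : α i₀ = y := if_pos rfl
  have a1 : α (i₀ + 1) = z := by simp only [α, if_neg n1, if_true]
  have a2 : α (i₀ + 2) = x := by simp only [α, if_neg n2, if_neg n3]
  refine ⟨α, fun i => ?_, ?_, fun i => ?_, fun h => ?_⟩
  · rcases key i with rfl | rfl | rfl
    · rwa [a0]
    · rwa [a1]
    · rwa [a2]
  · rw [← Fin.sum_univ_three, fin_three_sum_eq α i₀, a0, a1, a2]
    linarith
  · rcases key i with rfl | rfl | rfl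
    · rwa [a2]
    · rwa [fin_three_add_one_add_two, a0]
    · rwa [fin_three_add_two_add_two, a1]
  · rw [a2]
    exact h4 h

/-- Deviations that satisfy the inequalities of a simple arc-triangle are realized, with the
interior on the left. -/
theorem exists_simple_isInteriorAngle {g : Fin 3 → ℝ} (hg : ∀ i, |g i| < Real.pi)
    (hs : ∀ i, |g i + g (i + 2)| ≤ Real.pi) :
    ∃ T : ArcTriangle, T.Simple ∧ ∀ i, T.IsInteriorAngle i (Real.pi - (g i + g (i + 2))) := by
  -- The vertex `i₀` is one that has directions outside, if there is any.
  obtain ⟨i₀, hi₀⟩ : ∃ i₀, ∀ i, -Real.pi < g i + g (i + 2) → -Real.pi < g i₀ + g (i₀ + 2) := by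
    by_cases h : ∃ i, -Real.pi < g i + g (i + 2)
    · obtain ⟨i, hi⟩ := h
      exact ⟨i, fun _ _ => hi⟩
    · exact ⟨0, fun i hi => (h ⟨i, hi⟩).elim⟩
  obtain ⟨α, hα0, hαsum, hα, hαi⟩ := exists_angles_at hg hs i₀
  obtain ⟨T, hopp, hdev, hhalf, hv⟩ := exists_arcTriangle hα0 hαsum hg hα
  have hturn (i : Fin 3) : T.turn i = g i + g (i + 2) := by rw [turn, hdev, hdev]
  have hT : T.Simple := simple_of_abs_turn_le hopp fun i => by rw [hturn]; exact hs i
  have hpi := Real.pi_pos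
  have hsum : Real.pi + ∑ j, (T.half j + T.deviation j) ≠ 0 := by
    have : ∑ j, (T.half j + T.deviation j) = Real.pi := by
      rw [Fin.sum_univ_three, hhalf, hhalf, hhalf, hdev, hdev, hdev]
      change α 2 - g 0 + g 0 + (α 0 - g 1 + g 1) + (α 1 - g 2 + g 2) = Real.pi
      linarith
    rw [this]
    linarith
  have hsum' : α i₀ + α (i₀ + 1) + α (i₀ + 2) = Real.pi := by
    rw [← fin_three_sum_eq α i₀, Fin.sum_univ_three, hαsum]
  -- A vertex whose interior angle is `2π` has no directions outside.
  have hvac (i : Fin 3) (h : ¬ -Real.pi < T.turn i) : T.RightOutside i := by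
    intro t ht
    linarith [ht.1, ht.2]
  have hbase : T.RightOutside i₀ := by
    by_cases hi : -Real.pi < T.turn i₀
    swap
    · exact hvac _ hi
    obtain ⟨c, hc, hcv⟩ := hv i₀
    have hx := hαi (by rwa [← hturn])
    have b0 := hα0 i₀
    have b1 := hα0 (i₀ + 1)
    have b2 := hα0 (i₀ + 2)
    have f1 := hhalf (i₀ + 1)
    have f2 := hhalf (i₀ + 2)
    rw [fin_three_add_one_add_two] at f1
    rw [fin_three_add_two_add_two] at f2
    have hray : ∀ r : ℝ, 0 < r →
        T.vertex i₀ + r * -(T.vertex (i₀ + 1) - T.vertex i₀) ∉ T.boundary := fun r hr =>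
      prolonged_chord_notMem_boundary hc hcv b0 (by linarith)
        (by linarith [(abs_lt.1 (hg (i₀ + 1))).2]) (by linarith) hr
    have hne : -(T.vertex (i₀ + 1) - T.vertex i₀) ≠ 0 :=
      neg_ne_zero.2 (sub_ne_zero.2 (T.vertex_ne i₀).symm)
    have hdir : -(T.vertex (i₀ + 1) - T.vertex i₀) =
        cis (T.half i₀ + Real.pi) * T.startDir i₀ := by
      rw [startDir, cis_add, cis_pi]
      linear_combination (T.vertex (i₀ + 1) - T.vertex i₀) * cis_mul_cis_neg (T.half i₀)
    have hmem : T.half i₀ + Real.pi ∈ Ioo (Real.pi - T.turn i₀) (2 * Real.pi) := by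
      refine ⟨?_, by linarith [(abs_lt.1 (T.abs_half_lt i₀)).2]⟩
      rw [hturn, hhalf]
      linarith
    refine rightOutside_of_dirIn hT hmem (T.saturated_outside.dirIn
      (dirIn_compl_boundary_right hT i₀ hmem) (Eventually.frequently ?_))
    rw [← hdir]
    filter_upwards [self_mem_nhdsWithin] with r hr
    exact mem_outside_of_ray hne hray hr
  have hall (i : Fin 3) : T.RightOutside i := by
    by_cases hi : -Real.pi < T.turn i
    swap
    · exact hvac _ hi
    have h0 : -Real.pi < T.turn i₀ := by
      rw [hturn] at hi ⊢
      exact hi₀ i hi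
    have : i = i₀ ∨ i = i₀ + 1 ∨ i = i₀ + 2 := by clear * -; revert i i₀; decide
    rcases this with rfl | rfl | rfl
    · exact hbase
    · exact (rightOutside_add_one_iff hT h0 hi).1 hbase
    · have h := rightOutside_add_one_iff hT (i := i₀ + 2) hi (by
        rwa [fin_three_add_two_add_one])
      rw [fin_three_add_two_add_one] at h
      exact h.2 hbase
  refine ⟨T, hT, fun i => ?_⟩
  rw [← hturn]
  exact isInteriorAngle_of_rightOutside hT hsum (hall i)

end ArcTriangle

/-- Realizability in terms of the angles between the edges and the circumcircle. -/
theorem realizableBySimpleArcTriangle_iff {θ : Fin 3 → ℝ}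
    (hθ : ∀ i, θ i ∈ Icc 0 (2 * Real.pi)) :
    RealizableBySimpleArcTriangle θ ↔ ∀ i, |circumcircleAngle θ i| < Real.pi := by
  constructor
  · rintro ⟨T, hT, h⟩
    exact ArcTriangle.abs_circumcircleAngle_lt hT h
  · intro h
    have key (i : Fin 3) :
        circumcircleAngle θ (i + 2) + circumcircleAngle θ (i + 1) = Real.pi - θ i := by
      rw [circumcircleAngle, circumcircleAngle, fin_three_sum_eq θ i]
      ring
    obtain ⟨T, hT, hang⟩ := ArcTriangle.exists_simple_isInteriorAngle
      (g := fun i => circumcircleAngle θ (i + 2)) (fun i => h _) (fun i => by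
        rw [fin_three_add_two_add_two, key]
        exact abs_le.2 ⟨by linarith [(hθ i).2], by linarith [(hθ i).1]⟩)
    refine ⟨T, hT, fun i => ?_⟩
    have h1 := hang i
    rwa [fin_three_add_two_add_two, key, sub_sub_cancel] at h1

/-! ### The truncated cube -/

/-- The corner of the cube `[0, 2π]³` whose coordinates equal to `2π` are those marked by `b`. -/
noncomputable def cubeCorner (b : Fin 3 → Bool) (j : Fin 3) : ℝ :=
  if b j then 2 * Real.pi else 0

/-- The distance in the `j`-th coordinate of a point `θ` of the cube from `cubeCorner b`. -/
noncomputable def cornerDist (b : Fin 3 → Bool) (θ : Fin 3 → ℝ) (j : Fin 3) : ℝ :=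
  if b j then 2 * Real.pi - θ j else θ j

lemma cubeCorner_injective : Function.Injective cubeCorner := by
  intro b b' h
  ext j
  have := congrFun h j
  have hpi := Real.pi_pos.ne'
  cases hb : b j <;> cases hb' : b' j <;> simp_all [cubeCorner]

lemma mixedCorners_eq_image : mixedCorners = cubeCorner '' {b | ∃ i j, b i ≠ b j} := by
  have hpi := Real.pi_pos.ne'
  ext c
  constructor
  · rintro ⟨hc, i, j, hij⟩
    have hc' : cubeCorner (fun k => decide (c k = 2 * Real.pi)) = c := by
      ext k
      rcases hc k with h | h <;> simp [cubeCorner, h]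
    refine ⟨_, ⟨i, j, fun h => hij ?_⟩, hc'⟩
    rw [← congrFun hc' i, ← congrFun hc' j, cubeCorner, cubeCorner, h]
  · rintro ⟨b, ⟨i, j, hij⟩, rfl⟩
    refine ⟨fun k => ?_, i, j, fun h => hij ?_⟩
    · cases hb : b k <;> simp [cubeCorner, hb]
    · cases hb : b i <;> cases hb' : b j <;> simp_all [cubeCorner]

lemma ncard_mixedCorners : mixedCorners.ncard = 6 := by
  rw [mixedCorners_eq_image, Set.ncard_image_of_injective _ cubeCorner_injective]
  have : {b : Fin 3 → Bool | ∃ i j, b i ≠ b j} =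
      ((Finset.univ.filter fun b : Fin 3 → Bool => ∃ i j, b i ≠ b j : Finset _) : Set _) := by
    ext b
    simp
  rw [this, Set.ncard_coe_finset]
  decide

lemma convex_setOf_cornerDist (b : Fin 3 → Bool) :
    Convex ℝ {θ : Fin 3 → ℝ | (∀ j, 0 ≤ cornerDist b θ j) ∧ ∑ j, cornerDist b θ j ≤ Real.pi} := by
  rintro x ⟨hx, hx'⟩ y ⟨hy, hy'⟩ s t hs ht hst
  have key (j : Fin 3) : cornerDist b (s • x + t • y) j =
      s * cornerDist b x j + t * cornerDist b y j := by
    obtain rfl : t = 1 - s := by linarith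
    simp only [cornerDist, Pi.add_apply, Pi.smul_apply, smul_eq_mul]
    split_ifs <;> ring
  constructor
  · intro j
    rw [key]
    exact add_nonneg (mul_nonneg hs (hx j)) (mul_nonneg ht (hy j))
  · simp_rw [key]
    rw [Finset.sum_add_distrib, ← Finset.mul_sum, ← Finset.mul_sum]
    calc _ ≤ s * Real.pi + t * Real.pi := by gcongr
      _ = Real.pi := by rw [← add_mul, hst, one_mul]

/-- The tetrahedron at a corner consists of the points whose coordinates deviate from those of the
corner by at most `π` altogether. -/
lemma mem_cornerTetrahedron_iff (b : Fin 3 → Bool) (θ : Fin 3 → ℝ) :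
    θ ∈ cornerTetrahedron (cubeCorner b) ↔
      (∀ j, 0 ≤ cornerDist b θ j) ∧ ∑ j, cornerDist b θ j ≤ Real.pi := by
  have hpi := Real.pi_pos
  have hcorner (j : Fin 3) : cornerDist b (cubeCorner b) j = 0 := by
    cases hb : b j <;> simp [cornerDist, cubeCorner, hb]
  have hmid (i j : Fin 3) : cornerDist b (Function.update (cubeCorner b) i Real.pi) j =
      if j = i then Real.pi else 0 := by
    by_cases hij : j = i
    · subst hij
      cases hb : b j <;> simp [cornerDist, hb]
      ring
    · rw [if_neg hij, ← hcorner j, cornerDist, cornerDist, Function.update_of_ne hij]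
  constructor
  · intro h
    refine convexHull_min ?_ (convex_setOf_cornerDist b) h
    rintro _ (rfl | ⟨i, rfl⟩)
    · exact ⟨fun j => (hcorner j).ge, by simp [hcorner, hpi.le]⟩
    · refine ⟨fun j => ?_, ?_⟩
      · rw [hmid]
        split_ifs
        exacts [hpi.le, le_rfl]
      · simp [hmid]
  · rintro ⟨h0, h1⟩
    let w : Option (Fin 3) → ℝ := fun o =>
      o.elim (1 - ∑ j, cornerDist b θ j / Real.pi) fun j => cornerDist b θ j / Real.pi
    let p : Option (Fin 3) → Fin 3 → ℝ := fun o =>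
      o.elim (cubeCorner b) fun j => Function.update (cubeCorner b) j Real.pi
    have hw0 : ∀ o ∈ Finset.univ, 0 ≤ w o := by
      rintro (_ | j) -
      · change 0 ≤ 1 - ∑ j, cornerDist b θ j / Real.pi
        rw [← Finset.sum_div, sub_nonneg, div_le_one hpi]
        exact h1
      · exact div_nonneg (h0 j) hpi.le
    have hw1 : ∑ o, w o = 1 := by
      rw [Fintype.sum_option]
      exact sub_add_cancel _ _
    have hp : ∀ o ∈ Finset.univ, p o ∈ cornerTetrahedron (cubeCorner b) := by
      rintro (_ | j) -
      · exact subset_convexHull ℝ _ (mem_insert _ _)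
      · exact subset_convexHull ℝ _ (mem_insert_of_mem _ ⟨j, rfl⟩)
    suffices hcomb : θ = ∑ o, w o • p o from
      hcomb ▸ (convex_convexHull ℝ _).sum_mem hw0 hw1 hp
    ext k
    have e (j : Fin 3) : p (some j) k =
        cubeCorner b k + if j = k then Real.pi - cubeCorner b k else 0 := by
      change Function.update (cubeCorner b) j Real.pi k = _
      by_cases hjk : j = k
      · subst hjk
        simp
      · rw [if_neg hjk, Function.update_of_ne (Ne.symm hjk), add_zero]
    have e0 : p none k = cubeCorner b k := rfl
    have e1 : w none + ∑ j, w (some j) = 1 := by rw [← Fintype.sum_option, hw1]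
    have e2 : w (some k) = cornerDist b θ k / Real.pi := rfl
    simp only [Finset.sum_apply, Pi.smul_apply, smul_eq_mul, Fintype.sum_option, e, e0, mul_add,
      Finset.sum_add_distrib, ← Finset.sum_mul, mul_ite, mul_zero, Finset.sum_ite_eq',
      Finset.mem_univ, if_true]
    rw [← add_assoc, ← add_mul, e1, e2]
    cases hb : b k <;> simp only [cornerDist, cubeCorner, hb, if_true, Bool.false_eq_true, if_false]
      <;> field_simp <;> ring

/-- The inequality `|circumcircleAngle θ i| < π` fails exactly on the tetrahedra at the two corners
whose coordinate `i` differs from the other two. -/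
lemma forall_abs_circumcircleAngle_lt_iff {θ : Fin 3 → ℝ}
    (hθ : ∀ i, θ i ∈ Icc 0 (2 * Real.pi)) :
    (∀ i, |circumcircleAngle θ i| < Real.pi) ↔
      θ ∉ ⋃ c ∈ mixedCorners, cornerTetrahedron c := by
  have hdist (b : Fin 3 → Bool) (j : Fin 3) : 0 ≤ cornerDist b θ j := by
    cases hb : b j <;> simp [cornerDist, hb, (hθ j).1, (hθ j).2]
  have hφ (i : Fin 3) :
      circumcircleAngle θ i = (Real.pi + θ i - θ (i + 1) - θ (i + 2)) / 2 := by
    rw [circumcircleAngle, fin_three_sum_eq θ i]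
    ring
  have hunion : (θ ∈ ⋃ c ∈ mixedCorners, cornerTetrahedron c) ↔
      ∃ b : Fin 3 → Bool, (∃ i j, b i ≠ b j) ∧ ∑ j, cornerDist b θ j ≤ Real.pi := by
    rw [mixedCorners_eq_image, biUnion_image]
    simp only [mem_iUnion, mem_ofPred_eq, exists_prop, mem_cornerTetrahedron_iff]
    exact exists_congr fun b => and_congr_right fun _ => and_iff_right (hdist b)
  have hne1 : ∀ i : Fin 3, i + 1 ≠ i := by decide
  have hne2 : ∀ i : Fin 3, i + 2 ≠ i := by decide
  rw [← not_iff_not, not_not, hunion]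
  push Not
  constructor
  · rintro ⟨i, hi⟩
    rw [hφ] at hi
    rcases le_abs.1 hi with hi | hi
    · refine ⟨fun j => decide (j = i), ⟨i, i + 1, by simp [hne1]⟩, ?_⟩
      rw [fin_three_sum_eq _ i]
      simp only [cornerDist, hne1, hne2, decide_true, decide_false, if_true, Bool.false_eq_true,
        if_false]
      linarith
    · refine ⟨fun j => !decide (j = i), ⟨i, i + 1, by simp [hne1]⟩, ?_⟩
      rw [fin_three_sum_eq _ i]
      simp only [cornerDist, hne1, hne2, decide_true, decide_false, Bool.not_true, Bool.not_false,
        if_true, Bool.false_eq_true, if_false]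
      linarith
  · rintro ⟨b, hb, hsum⟩
    obtain ⟨i, h1, h2⟩ : ∃ i, b (i + 1) = !b i ∧ b (i + 2) = !b i := by
      clear * - hb
      revert b
      decide
    refine ⟨i, ?_⟩
    rw [hφ, le_abs]
    rw [fin_three_sum_eq _ i] at hsum
    cases hbi : b i
    · right
      simp only [cornerDist, h1, h2, hbi, Bool.not_false, if_true, Bool.false_eq_true,
        if_false] at hsum
      linarith
    · left
      simp only [cornerDist, h1, h2, hbi, Bool.not_true, if_true, Bool.false_eq_true,
        if_false] at hsum
      linarith

theorem mainTheorem1 :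
    (∀ θ : Fin 3 → ℝ, (∀ i, θ i ∈ Icc 0 (2 * Real.pi)) →
      (RealizableBySimpleArcTriangle θ ↔
        ∀ i, -Real.pi < circumcircleAngle θ i ∧ circumcircleAngle θ i < Real.pi)) ∧
    mixedCorners.ncard = 6 ∧
    {θ : Fin 3 → ℝ | RealizableBySimpleArcTriangle θ} =
      angleCube \ ⋃ c ∈ mixedCorners, cornerTetrahedron c := by
  refine ⟨fun θ hθ => ?_, ncard_mixedCorners, ?_⟩
  · simp_rw [realizableBySimpleArcTriangle_iff hθ, abs_lt]
  · ext θ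
    constructor
    · rintro ⟨T, hT, h⟩
      have hθ : ∀ i, θ i ∈ Icc 0 (2 * Real.pi) := fun i => (h i).1
      exact ⟨hθ, (forall_abs_circumcircleAngle_lt_iff hθ).1
        ((realizableBySimpleArcTriangle_iff hθ).1 ⟨T, hT, h⟩)⟩
    · rintro ⟨hθ, h⟩
      exact (realizableBySimpleArcTriangle_iff hθ).2
        ((forall_abs_circumcircleAngle_lt_iff hθ).2 h)
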